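/- Let $\mathcal H=(\mathbb C^2)^{\otimes n}$, $d=2^n$, with computational basis $|\mathbf s\rangle$, $\mathbf s\in\{0,1\}^n$. Let $\overline{\mathcal P}_n=\{I,X,Y,Z\}^{\otimes n}$ be the set of Pauli operators, and let $\mathrm{Cl}_n$ be the Clifford group, i.e. the normalizer of the Pauli group $\{i^kP : k\in\mathbb Z,\ P\in\overline{\mathcal P}_n\}$ in the unitary group; $\mathbb E_{U\sim \mathrm{Cl}_n}$ denotes the uniform average over the finite group $\mathrm{Cl}_n$ modulo global phases. The measurement channel is $\mathcal M(X)=\mathbb E_{U\sim\mathrm{Cl}_n}\sum_{\mathbf s}\langle \mathbf s|UXU^\dagger|\mathbf s\rangle\, U^\dagger|\mathbf s\rangle\langle \mathbf s|U$, and $$\Omega=\sum_{\mathbf s,\mathbf t}\mathbb E_{U\sim\mathrm{Cl}_n}U^{\dagger\otimes 4}\bigl[(|\mathbf s\rangle\langle\mathbf s|)^{\otimes2}\otimes(|\mathbf t\rangle\langle\mathbf t|)^{\otimes 2}\bigr]U^{\otimes 4},\qquad \mathbb V_*(O,\tau)=\operatorname{Tr}\bigl\{\Omega\,[\mathcal M^{-1}(O)\otimes\tau]^{\otimes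 2}\bigr\}-[\operatorname{Tr}(O\tau)]^2 .$$ For $P\in\overline{\mathcal P}_n$ let $\Xi_A(P)=\operatorname{Tr}(AP)$, $\Xi_{A,B}(P)=\operatorname{Tr}(AP)\operatorname{Tr}(BP)$ and $\tilde\Xi_{A,B}(P)=\operatorname{Tr}(APBP)$, regarded as vectors with $d^2$ entries, with $\ell_p$-norms $\|\Xi\|_p$; for operators $\|\cdot\|_p$ is the Schatten $p$-norm. For a pure state $\sigma$ let $M_2(\sigma)=\log_2\bigl(d/\|\Xi_\sigma\|_4^4\bigr)$ (the stabilizer 2-Rényi entropy). **Theorem.** Let $\rho,\sigma$ be density operators on $\mathcal H$, $\Delta=\rho-\sigma$, $\epsilon=1-\|\sqrt\rho\sqrt\sigma\|_1^2$, and let $O$ be a traceless Hermitian operator on $\mathcal H$. Then $\mathcal M$ is invertible, $\mathbb V_*(O,\Delta)$ is real, and $$\mathbb V_*(O,\Delta)=\frac{d+1}{d(d+2)}\Bigl(\|\Xi_{\Delta,O}\|_2^2+\tilde\Xi_{\Delta,O}\cdot\Xi_{\Delta,O}\Bigr)-\frac{[\operatorname{Tr}(\Delta O)]^2}{d+2}\le\frac2d\|\Xi_{\Delta,O}\|_2^2\le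 2\|\Delta\|_1^2\|O\|_2^2\le 8\epsilon\|O\|_2^2 .$$ If moreover $\sigma$ is a pure state and $O=\sigma-\mathbb 1/d$, then $$\mathbb V_*(O,\Delta)\le 2^{2-M_2(\sigma)/2}\min\bigl\{\sqrt2\,\epsilon,\ \|\Delta\|_2^2\bigr\}.$$ -/

import Mathlib

namespace CRM

open scoped Kronecker ComplexOrder MatrixOrder ENNReal

noncomputable section

/-- Labels `s ∈ {0,1}^n` of the computational basis of `n` qubits. -/
abbrev Bits (n : ℕ) : Type := Fin n → Fin 2

/-- Operators on the `n`-qubit Hilbert space of dimension `d = 2 ^ n`. -/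
abbrev Op (n : ℕ) : Type := Matrix (Bits n) (Bits n) ℂ

/-- The dimension `d = 2 ^ n`, as a real number. -/
def dim (n : ℕ) : ℝ := 2 ^ n

/-! ### States -/

/-- Density operators. -/
def IsDensity {n : ℕ} (ρ : Op n) : Prop := ρ.PosSemidef ∧ ρ.trace = 1

/-- Pure states `|φ⟩⟨φ|` with `⟨φ|φ⟩ = 1`. -/
def IsPure {n : ℕ} (σ : Op n) : Prop :=
  ∃ φ : Bits n → ℂ, star φ ⬝ᵥ φ = 1 ∧ σ = Matrix.vecMulVec φ (star φ)

/-- The Schatten `p`-norm: the `ℓ_p`-norm of the singular values, which are the square roots of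
the eigenvalues of `A† A`. -/
def schattenNorm {n : ℕ} (p : ℝ) (A : Op n) : ℝ :=
  (∑ i, Real.sqrt ((Matrix.isHermitian_conjTranspose_mul_self A).eigenvalues i) ^ p) ^ (1 / p)

/-- The infidelity `1 - ‖√ρ √σ‖₁²`. -/
def infidelity {n : ℕ} (ρ σ : Op n) : ℝ :=
  1 - schattenNorm 1 (CFC.sqrt ρ * CFC.sqrt σ) ^ 2

/-! ### Pauli operators -/

/-- The single-qubit operators `I, X, Y, Z`. -/
def pauli1 : Fin 4 → Matrix (Fin 2) (Fin 2) ℂ :=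
  ![1, !![0, 1; 1, 0], !![0, -Complex.I; Complex.I, 0], !![1, 0; 0, -1]]

/-- The `n`-qubit Pauli operator `P₁ ⊗ ⋯ ⊗ Pₙ`; the map `p ↦ pauli p` is a bijection onto
`{I, X, Y, Z}^{⊗ n}`. -/
def pauli {n : ℕ} (p : Fin n → Fin 4) : Op n :=
  Matrix.of fun s t => ∏ k, pauli1 (p k) (s k) (t k)

theorem pauli1_conjTranspose (a : Fin 4) : (pauli1 a).conjTranspose = pauli1 a := by
  fin_cases a <;> ext i j <;> fin_cases i <;> fin_cases j <;> simp [pauli1]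

theorem pauli1_mul (a b : Fin 4) :
    ∃ (k : ℕ) (c : Fin 4), pauli1 a * pauli1 b = Complex.I ^ k • pauli1 c := by
  have key : ∀ (k : ℕ) (c : Fin 4), pauli1 a * pauli1 b = Complex.I ^ k • pauli1 c →
      ∃ (k : ℕ) (c : Fin 4), pauli1 a * pauli1 b = Complex.I ^ k • pauli1 c :=
    fun k c h => ⟨k, c, h⟩
  by_cases hab : a = b
  · subst hab
    refine key 0 0 ?_
    fin_cases a <;> ext i j <;> fin_cases i <;> fin_cases j <;>
      simp [pauli1, Matrix.mul_apply]
  · by_cases ha : a = 0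
    · subst ha
      exact key 0 b (by simp [pauli1])
    · by_cases hb : b = 0
      · subst hb
        exact key 0 a (by simp [pauli1])
      · refine key (if b = a + 1 ∨ (a = 3 ∧ b = 1) then 1 else 3) (6 - a - b) ?_
        fin_cases a <;> fin_cases b <;> simp_all <;>
          (ext i j; fin_cases i <;> fin_cases j <;>
            simp [pauli1, Matrix.mul_apply])

theorem pauli1_sum (i j s t : Fin 2) :
    ∑ a, (1 / 2 * pauli1 a j i) * pauli1 a s t = if s = i ∧ t = j then 1 else 0 := by
  fin_cases i <;> fin_cases j <;> fin_cases s <;> fin_cases t <;>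
    simp [pauli1, Fin.sum_univ_four] <;> norm_num <;> ring_nf <;> simp <;> norm_num

theorem pauli_conjTranspose {n : ℕ} (p : Fin n → Fin 4) :
    (pauli p).conjTranspose = pauli p := by
  ext s t
  simp only [pauli, Matrix.conjTranspose_apply, Matrix.of_apply, star_prod]
  refine Finset.prod_congr rfl fun k _ => ?_
  rw [← Matrix.conjTranspose_apply, pauli1_conjTranspose]

theorem pauli_zero {n : ℕ} : pauli (0 : Fin n → Fin 4) = 1 := by
  ext s t
  simp only [pauli, pauli1, Matrix.of_apply, Pi.zero_apply, Matrix.cons_val_zero,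
    Matrix.one_apply]
  rw [Finset.prod_ite_zero]
  simp [funext_iff]

theorem pauli_mul {n : ℕ} (p q : Fin n → Fin 4) :
    ∃ (k : ℕ) (r : Fin n → Fin 4), pauli p * pauli q = Complex.I ^ k • pauli r := by
  choose f g h using pauli1_mul
  refine ⟨∑ k, f (p k) (q k), fun k => g (p k) (q k), ?_⟩
  ext s t
  simp only [pauli, Matrix.mul_apply, Matrix.of_apply, Matrix.smul_apply, smul_eq_mul,
    ← Finset.prod_mul_distrib, ← Finset.prod_pow_eq_pow_sum]
  rw [← Fintype.piFinset_univ, ← Finset.prod_univ_sum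
    (fun _ => Finset.univ) (fun k u => pauli1 (p k) (s k) u * pauli1 (q k) u (t k))]
  refine Finset.prod_congr rfl fun k _ => ?_
  rw [← Matrix.mul_apply, h, Matrix.smul_apply, smul_eq_mul]

theorem pauli_sq {n : ℕ} (p : Fin n → Fin 4) : pauli p * pauli p = 1 := by
  have h : ∀ a : Fin 4, pauli1 a * pauli1 a = 1 := by
    intro a
    fin_cases a <;> ext i j <;> fin_cases i <;> fin_cases j <;>
      simp [pauli1, Matrix.mul_apply]
  ext s t
  simp only [pauli, Matrix.mul_apply, Matrix.of_apply, ← Finset.prod_mul_distrib]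
  rw [← Fintype.piFinset_univ, ← Finset.prod_univ_sum
    (fun _ => Finset.univ) (fun k u => pauli1 (p k) (s k) u * pauli1 (p k) u (t k))]
  simp only [← Matrix.mul_apply, h, Matrix.one_apply]
  rw [Finset.prod_ite_zero]
  simp [funext_iff]

/-! ### The Clifford group -/

/-- The Pauli group: the unitaries `i^k P` with `P` a Pauli operator. -/
def pauliGroup (n : ℕ) : Subgroup (Matrix.unitaryGroup (Bits n) ℂ) where
  carrier := {U | ∃ (k : ℕ) (p : Fin n → Fin 4), (U : Op n) = Complex.I ^ k • pauli p}
  mul_mem' := by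
    rintro U V ⟨k, p, hU⟩ ⟨l, q, hV⟩
    obtain ⟨m, r, h⟩ := pauli_mul p q
    refine ⟨k + l + m, r, ?_⟩
    rw [Submonoid.coe_mul, hU, hV, Matrix.smul_mul, Matrix.mul_smul, h, smul_smul, smul_smul,
      pow_add, pow_add, mul_assoc]
  one_mem' := ⟨0, 0, by simp [pauli_zero]⟩
  inv_mem' := by
    rintro U ⟨k, p, hU⟩
    refine ⟨3 * k, p, ?_⟩
    have : ((U⁻¹ : Matrix.unitaryGroup (Bits n) ℂ) : Op n) = (U : Op n).conjTranspose := rfl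
    rw [this, hU, Matrix.conjTranspose_smul, pauli_conjTranspose, pow_mul, Complex.I_pow_three]
    simp

/-- The Clifford group `Cl_n`: the normalizer of the Pauli group in the unitary group. -/
def cliffordGroup (n : ℕ) : Subgroup (Matrix.unitaryGroup (Bits n) ℂ) :=
  Subgroup.normalizer (pauliGroup n : Set (Matrix.unitaryGroup (Bits n) ℂ))

/-- The global phases in the Clifford group. -/
def phases (n : ℕ) : Subgroup (cliffordGroup n) where
  carrier := {U | ∃ c : ℂ, ((U : Matrix.unitaryGroup (Bits n) ℂ) : Op n) = c • (1 : Op n)}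
  mul_mem' := by
    rintro U V ⟨a, hU⟩ ⟨b, hV⟩
    exact ⟨a * b, by simp [hU, hV, smul_smul, mul_comm]⟩
  one_mem' := ⟨1, by simp⟩
  inv_mem' := by
    rintro U ⟨a, hU⟩
    refine ⟨star a, ?_⟩
    have : ((((U⁻¹ : cliffordGroup n) : Matrix.unitaryGroup (Bits n) ℂ)) : Op n)
        = ((U : Matrix.unitaryGroup (Bits n) ℂ) : Op n).conjTranspose := rfl
    rw [this, hU]
    simp

/-- The Clifford group modulo global phases. -/
abbrev ProjClifford (n : ℕ) : Type := cliffordGroup n ⧸ phases n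

theorem single_eq_sum_pauli {n : ℕ} (i j : Bits n) :
    Matrix.single i j (1 : ℂ)
      = ∑ p : Fin n → Fin 4, (∏ k, (1 / 2 * pauli1 (p k) (j k) (i k))) • pauli p := by
  ext s t
  simp only [Matrix.sum_apply, Matrix.smul_apply, pauli, Matrix.of_apply, smul_eq_mul,
    ← Finset.prod_mul_distrib]
  rw [← Fintype.piFinset_univ, ← Finset.prod_univ_sum (fun _ => Finset.univ)
    (fun k a => (1 / 2 * pauli1 a (j k) (i k)) * pauli1 a (s k) (t k))]
  simp only [pauli1_sum]
  rw [Finset.prod_ite_zero]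
  simp only [Matrix.single_apply, Finset.mem_univ, forall_true_left, Finset.prod_const_one,
    funext_iff, forall_and]
  congr 1
  simp only [eq_comm]

theorem scalar_of_commute_pauli {n : ℕ} (W : Op n)
    (h : ∀ p : Fin n → Fin 4, pauli p * W = W * pauli p) : ∃ c : ℂ, W = c • (1 : Op n) := by
  obtain ⟨c, hc⟩ := Matrix.mem_range_scalar_of_commute_single (M := W) (fun i j _ => by
    change Commute (Matrix.single i j 1) W
    rw [single_eq_sum_pauli]
    refine Commute.sum_left _ _ _ fun p _ => ?_
    exact Commute.smul_left (h p) _)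
  refine ⟨c, ?_⟩
  rw [← hc]
  ext s t
  simp [Matrix.diagonal_apply, Matrix.one_apply]

theorem finite_pauliGroup (n : ℕ) : Finite (pauliGroup n) := by
  have hfin : Set.Finite
      (Set.range fun x : Fin 4 × (Fin n → Fin 4) => Complex.I ^ (x.1 : ℕ) • pauli x.2) :=
    Set.finite_range _
  refine Set.Finite.of_injOn (s := (pauliGroup n : Set (Matrix.unitaryGroup (Bits n) ℂ)))
    (f := fun U : Matrix.unitaryGroup (Bits n) ℂ => (U : Op n)) ?_ (fun U _ V _ h => Subtype.ext h) hfin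
  rintro U ⟨k, p, hU⟩
  refine ⟨(⟨k % 4, Nat.mod_lt _ (by norm_num)⟩, p), ?_⟩
  simp only [hU]
  conv_rhs => rw [← Nat.div_add_mod k 4, pow_add, pow_mul, Complex.I_pow_four, one_pow, one_mul]

instance finite_projClifford (n : ℕ) : Finite (ProjClifford n) := by
  have := finite_pauliGroup n
  -- the phases contain the kernel of the conjugation action on the Pauli group
  let φ : cliffordGroup n →* MulAut (pauliGroup n) := (pauliGroup n).normalizerMonoidHom
  have hker : φ.ker ≤ phases n := by
    intro U hU
    rw [MonoidHom.mem_ker] at hU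
    refine scalar_of_commute_pauli _ fun p => ?_
    have hp : pauli p ∈ Matrix.unitaryGroup (Bits n) ℂ := by
      rw [Matrix.mem_unitaryGroup_iff, Matrix.star_eq_conjTranspose, pauli_conjTranspose,
        pauli_sq]
    let P : pauliGroup n := ⟨⟨pauli p, hp⟩, 0, p, by simp⟩
    have h1 := congrArg (fun f : MulAut (pauliGroup n) =>
      (((f P : pauliGroup n) : Matrix.unitaryGroup (Bits n) ℂ))) hU
    have h2 : (U : Matrix.unitaryGroup (Bits n) ℂ) * P * (U : Matrix.unitaryGroup (Bits n) ℂ)⁻¹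
        = P := h1
    rw [mul_inv_eq_iff_eq_mul] at h2
    exact (congrArg (fun V : Matrix.unitaryGroup (Bits n) ℂ => (V : Op n)) h2).symm
  have : Finite (cliffordGroup n ⧸ φ.ker) :=
    Finite.of_equiv _ (QuotientGroup.quotientKerEquivRange φ).symm.toEquiv
  exact Finite.of_surjective (Subgroup.quotientMapOfLE hker) fun x => by
    induction x using QuotientGroup.induction_on with
    | H g => exact ⟨(g : cliffordGroup n ⧸ φ.ker), rfl⟩

instance fintype_projClifford (n : ℕ) : Fintype (ProjClifford n) := Fintype.ofFinite _

/-- The Clifford ensemble: each element of the Clifford group modulo phases is represented by a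
unitary. All quantities below are independent of the phases of these representatives. -/
def cliffordEnsemble (n : ℕ) (g : ProjClifford n) : Matrix.unitaryGroup (Bits n) ℂ :=
  (Quotient.out g : cliffordGroup n)

/-! ### Shadow estimation with the uniform distribution on a finite family of unitaries -/

/-- The uniform average `𝔼_U f(U)` over a finite family of unitaries. -/
def avg {n : ℕ} {ι : Type*} [Fintype ι] {V : Type*} [AddCommGroup V] [Module ℂ V]
    (𝒰 : ι → Matrix.unitaryGroup (Bits n) ℂ) (f : Op n → V) : V :=
  (Fintype.card ι : ℂ)⁻¹ • ∑ i, f (𝒰 i : Op n)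

/-- The projector `|s⟩⟨s|`. -/
def basisProj {n : ℕ} (s : Bits n) : Op n := Matrix.single s s 1

/-- The measurement channel `X ↦ 𝔼_U ∑ₛ ⟨s|U X U†|s⟩ U†|s⟩⟨s|U`. -/
def measurementChannel {n : ℕ} {ι : Type*} [Fintype ι]
    (𝒰 : ι → Matrix.unitaryGroup (Bits n) ℂ) : Module.End ℂ (Op n) where
  toFun X := avg 𝒰 fun U =>
    ∑ s, (U * X * U.conjTranspose) s s • (U.conjTranspose * basisProj s * U)
  map_add' X Y := by
    simp only [avg, Matrix.mul_add, Matrix.add_mul, Matrix.add_apply, add_smul,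
      Finset.sum_add_distrib, smul_add]
  map_smul' c X := by
    simp only [avg, Matrix.mul_smul, Matrix.smul_mul, Matrix.smul_apply, smul_eq_mul,
      RingHom.id_apply, Finset.smul_sum, smul_smul]
    refine Finset.sum_congr rfl fun i _ => Finset.sum_congr rfl fun s _ => ?_
    congr 1
    ring

/-- The reconstruction map, the inverse of the measurement channel (for an invertible channel). -/
def reconstruction {n : ℕ} {ι : Type*} [Fintype ι]
    (𝒰 : ι → Matrix.unitaryGroup (Bits n) ℂ) : Module.End ℂ (Op n) :=
  Ring.inverse (measurementChannel 𝒰)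

/-- `A ⊗ A`. -/
def tensorSq {m : Type*} (A : Matrix m m ℂ) : Matrix (m × m) (m × m) ℂ := A ⊗ₖ A

/-- The fourth cross moment operator
`Ω(𝒰) = ∑_{s,t} 𝔼_U U†^{⊗4} [(|s⟩⟨s|)^{⊗2} ⊗ (|t⟩⟨t|)^{⊗2}] U^{⊗4}`. -/
def crossMoment {n : ℕ} {ι : Type*} [Fintype ι] (𝒰 : ι → Matrix.unitaryGroup (Bits n) ℂ) :
    Matrix ((Bits n × Bits n) × (Bits n × Bits n)) ((Bits n × Bits n) × (Bits n × Bits n)) ℂ :=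
  ∑ s, ∑ t, avg 𝒰 fun U =>
    tensorSq (tensorSq U.conjTranspose) * (tensorSq (basisProj s) ⊗ₖ tensorSq (basisProj t)) *
      tensorSq (tensorSq U)

/-- `V_*(O, τ) = Tr{Ω(𝒰) [𝓜⁻¹(O) ⊗ τ]^{⊗2}} - [Tr(O τ)]²`. -/
def varStar {n : ℕ} {ι : Type*} [Fintype ι] (𝒰 : ι → Matrix.unitaryGroup (Bits n) ℂ)
    (O τ : Op n) : ℂ :=
  (crossMoment 𝒰 * tensorSq (reconstruction 𝒰 O ⊗ₖ τ)).trace - (O * τ).trace ^ 2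

/-! ### Characteristic functions -/

/-- The `ℓ_p`-norm of a function on the Pauli operators. -/
def lpNorm {n : ℕ} (p : ℝ≥0∞) (f : (Fin n → Fin 4) → ℂ) : ℝ := ‖WithLp.toLp p f‖

/-- The characteristic function `Ξ_O(P) = Tr(O P)`. -/
def charFn {n : ℕ} (O : Op n) (p : Fin n → Fin 4) : ℂ := (O * pauli p).trace

/-- The cross characteristic function `Ξ_{A,B}(P) = Tr(A P) Tr(B P)`. -/
def crossChar {n : ℕ} (A B : Op n) (p : Fin n → Fin 4) : ℂ :=
  (A * pauli p).trace * (B * pauli p).trace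

/-- The twisted cross characteristic function `Ξ̃_{A,B}(P) = Tr(A P B P)`. -/
def twistedCrossChar {n : ℕ} (A B : Op n) (p : Fin n → Fin 4) : ℂ :=
  (A * pauli p * B * pauli p).trace

/-- `V_∘(O, Δ) = (d+1)/(d(d+2)) (‖Ξ_{Δ,O}‖₂² + Ξ̃_{Δ,O} · Ξ_{Δ,O})`. -/
def varCirc {n : ℕ} (O Δ : Op n) : ℂ :=
  ((dim n + 1) / (dim n * (dim n + 2)) : ℝ) *
    ((lpNorm 2 (crossChar Δ O) ^ 2 : ℝ) + star (twistedCrossChar Δ O) ⬝ᵥ crossChar Δ O)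

/-- The stabilizer 2-Rényi entropy `M₂(σ) = log₂(d / ‖Ξ_σ‖₄⁴)`. -/
def stabilizerEntropy {n : ℕ} (σ : Op n) : ℝ :=
  Real.logb 2 (dim n / lpNorm 4 (charFn σ) ^ 4)

end

end CRM

namespace CRM

open scoped Kronecker ComplexOrder MatrixOrder ENNReal

noncomputable section

/-! Write `d = 2^n`. A Clifford unitary permutes the Pauli operators up to sign, and only products
of `I` and `Z` have a nonzero diagonal. Expanding in Paulis turns `∑ₛ ⟨s|UAU†|s⟩⟨s|UBU†|s⟩` into
`d⁻¹` times the sum of `Tr(AP) Tr(BP)` over those `P` for which `UPU†` is diagonal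
(`sum_conj_diag_mul`). The trace against `Ω` is the mean square of this quantity, so everything
reduces to the probability `diagProb p q` that two Paulis become diagonal together.

That probability follows from symmetry and counting. Anticommuting Paulis are never both diagonal.
Rotations about Paulis show that the Clifford stabilizer of `p` is transitive on the Paulis
commuting with `p`, apart from `1` and `p` (`exists_clifford_conj`). Each Clifford makes exactly `d`
Paulis diagonal. Hence the values are `1/(d+1)` for one nonidentity Pauli and `2/((d+1)(d+2))` for a
distinct commuting nonidentity pair. The first value makes the channel depolarizing, hence
invertible. Both together give the variance formula, with the commutation sign producing `Ξ̃`
(`sum_commSign_crossChar`).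

For the bounds, the sign matrix is `d` times an orthogonal matrix, so `Ξ` and `Ξ̃` have equal
`ℓ₂`-norms and Cauchy–Schwarz applies. Then `|Tr(ΔP)| ≤ ‖Δ‖₁`, Parseval for `O` and Fuchs–van de
Graaf finish the general chain.

For pure `σ`, Cauchy–Schwarz separates `‖Ξ_σ‖₄⁴` from `‖Ξ_Δ‖₄⁴`. The latter is at most `max |Ξ_Δ|² ·
d‖Δ‖₂²`, where the maximum is bounded by `4ε` or by `4‖Δ‖₂²`, and `‖Δ‖₂² ≤ 2ε`. -/

theorem sum_pi_prod {R : Type*} [CommSemiring R] {n : ℕ} {κ : Type*} [Fintype κ] [DecidableEq κ]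
    (f : Fin n → κ → R) : ∑ r : Fin n → κ, ∏ k, f k (r k) = ∏ k, ∑ a, f k a := by
  rw [← Fintype.piFinset_univ, ← Finset.prod_univ_sum (fun _ => Finset.univ) f]

/-! ### Commutation signs of Pauli operators -/

/-- The sign in `P Q = ± Q P` for single-qubit Pauli operators. -/
def commSign1 (a b : Fin 4) : ℤ := if a = 0 ∨ b = 0 ∨ a = b then 1 else -1

/-- The sign in `P Q = ± Q P` for Pauli operators. -/
def commSign {n : ℕ} (p q : Fin n → Fin 4) : ℤ := ∏ k, commSign1 (p k) (q k)

theorem commSign_comm {n : ℕ} (p q : Fin n → Fin 4) : commSign p q = commSign q p := by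
  refine Finset.prod_congr rfl fun k _ => ?_
  simp only [commSign1]
  congr 1
  simp only [eq_comm (a := p k) (b := q k)]
  grind

theorem commSign_zero_left {n : ℕ} (q : Fin n → Fin 4) : commSign 0 q = 1 := by
  simp [commSign, commSign1]

theorem commSign_self {n : ℕ} (q : Fin n → Fin 4) : commSign q q = 1 := by
  simp [commSign, commSign1]

theorem commSign_eq_or {n : ℕ} (p q : Fin n → Fin 4) : commSign p q = 1 ∨ commSign p q = -1 := by
  rw [← Int.isUnit_iff]
  unfold commSign
  refine (Finset.univ.prod_induction _ IsUnit (fun _ _ => IsUnit.mul) isUnit_one ?_)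
  intro k _
  unfold commSign1
  split_ifs <;> simp

theorem pauli1_mul_comm (a b : Fin 4) :
    pauli1 a * pauli1 b = (commSign1 a b : ℂ) • (pauli1 b * pauli1 a) := by
  fin_cases a <;> fin_cases b <;> ext i j <;> fin_cases i <;> fin_cases j <;>
    simp [pauli1, commSign1, Matrix.mul_apply]

theorem pauli_mul_apply {n : ℕ} (p q : Fin n → Fin 4) (s t : Bits n) :
    (pauli p * pauli q) s t = ∏ k, (pauli1 (p k) * pauli1 (q k)) (s k) (t k) := by
  simp only [pauli, Matrix.mul_apply, Matrix.of_apply, ← Finset.prod_mul_distrib]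
  exact sum_pi_prod (fun k u => pauli1 (p k) (s k) u * pauli1 (q k) u (t k))

theorem pauli_mul_comm {n : ℕ} (p q : Fin n → Fin 4) :
    pauli p * pauli q = (commSign p q : ℂ) • (pauli q * pauli p) := by
  ext s t
  rw [Matrix.smul_apply, pauli_mul_apply, pauli_mul_apply, commSign, smul_eq_mul, Int.cast_prod,
    ← Finset.prod_mul_distrib]
  refine Finset.prod_congr rfl fun k _ => ?_
  rw [pauli1_mul_comm, Matrix.smul_apply, smul_eq_mul]

/-- Orthogonality of characters: the sum factorizes over qubits, where it is a finite table. -/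
theorem sum_commSign_mul {n : ℕ} (p q : Fin n → Fin 4) :
    ∑ r, commSign p r * commSign q r = if p = q then 4 ^ n else 0 := by
  have h1 : ∀ a b : Fin 4, ∑ c, commSign1 a c * commSign1 b c = if a = b then 4 else 0 := by
    decide
  simp only [commSign, ← Finset.prod_mul_distrib]
  rw [sum_pi_prod (fun k c => commSign1 (p k) c * commSign1 (q k) c)]
  simp only [h1]
  rw [Finset.prod_ite_zero]
  simp [funext_iff]

theorem sum_commSign_mul_mul_nonneg {n : ℕ} (p q p' : Fin n → Fin 4) :
    0 ≤ ∑ r, commSign p r * commSign q r * commSign p' r := by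
  have h1 : ∀ a b b' : Fin 4, 0 ≤ ∑ c, commSign1 a c * commSign1 b c * commSign1 b' c := by
    decide
  simp only [commSign, ← Finset.prod_mul_distrib]
  rw [sum_pi_prod (fun k c => commSign1 (p k) c * commSign1 (q k) c * commSign1 (p' k) c)]
  exact Finset.prod_nonneg fun k _ => h1 _ _ _

theorem sum_commSign {n : ℕ} (p : Fin n → Fin 4) :
    ∑ r, commSign p r = if p = 0 then 4 ^ n else 0 := by
  have := sum_commSign_mul p 0
  simpa only [commSign_zero_left, mul_one] using this

/-- A Pauli operator commuting with `p` and anticommuting with `q` and `q'` exists as soon as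
neither `q` nor `q'` is the identity or `p`. -/
theorem exists_commSign {n : ℕ} {p q q' : Fin n → Fin 4} (hq : q ≠ 0) (hq' : q' ≠ 0)
    (hpq : p ≠ q) (hpq' : p ≠ q') :
    ∃ r, commSign p r = 1 ∧ commSign q r = -1 ∧ commSign q' r = -1 := by
  -- Each summand is eight times the indicator of the desired `r`. After expansion every term with a
  -- minus sign sums to zero, the constant term gives `4 ^ n`, and the rest are nonnegative.
  have hsum : 0 < ∑ r, (1 + commSign p r) * ((1 - commSign q r) * (1 - commSign q' r)) := by
    have e : ∀ r, (1 + commSign p r) * ((1 - commSign q r) * (1 - commSign q' r)) =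
        1 + commSign p r - commSign q r - commSign q' r + commSign q r * commSign q' r
        - commSign p r * commSign q r - commSign p r * commSign q' r
        + commSign p r * commSign q r * commSign q' r := fun r => by ring
    simp only [e, Finset.sum_add_distrib, Finset.sum_sub_distrib, sum_commSign_mul, sum_commSign,
      if_neg hq, if_neg hq', if_neg hpq, if_neg hpq']
    have := sum_commSign_mul_mul_nonneg p q q'
    have h4 : (0 : ℤ) < 4 ^ n := by positivity
    have h5 : ∑ _r : Fin n → Fin 4, (1 : ℤ) = 4 ^ n := by simp
    split_ifs <;> linarith
  obtain ⟨r, -, hr⟩ := Finset.exists_ne_zero_of_sum_ne_zero hsum.ne'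
  refine ⟨r, ?_⟩
  rcases commSign_eq_or p r with h1 | h1 <;> rcases commSign_eq_or q r with h2 | h2 <;>
    rcases commSign_eq_or q' r with h3 | h3 <;> simp_all

/-! ### Pauli expansion, Parseval, and orthogonality relations -/

/-- This is `∑ P ⊗ P = d · SWAP`, obtained qubit by qubit; the Pauli expansion of an operator and
Parseval follow from it. -/
theorem sum_pauli_mul_pauli {n : ℕ} (i j k l : Bits n) :
    ∑ p : Fin n → Fin 4, pauli p i j * pauli p k l = if i = l ∧ j = k then 2 ^ n else 0 := by
  have h1 : ∀ i j k l : Fin 2, ∑ a, pauli1 a i j * pauli1 a k l =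
      if i = l ∧ j = k then 2 else 0 := by
    intro i j k l
    have := pauli1_sum l k i j
    have e : ∑ a, pauli1 a i j * pauli1 a k l
        = 2 * ∑ a, (1 / 2 * pauli1 a k l) * pauli1 a i j := by
      rw [Finset.mul_sum]
      exact Finset.sum_congr rfl fun a _ => by ring
    rw [e, this]
    simp
  simp only [pauli, Matrix.of_apply, ← Finset.prod_mul_distrib]
  rw [sum_pi_prod (fun m a => pauli1 a (i m) (j m) * pauli1 a (k m) (l m))]
  simp only [h1]
  rw [Finset.prod_ite_zero]
  simp [funext_iff, forall_and]

theorem sum_trace_mul_pauli_smul {n : ℕ} (A : Op n) :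
    ∑ p : Fin n → Fin 4, (A * pauli p).trace • pauli p = (2 ^ n : ℂ) • A := by
  ext s t
  simp only [Matrix.sum_apply, Matrix.smul_apply, Matrix.trace, Matrix.diag_apply,
    Matrix.mul_apply, smul_eq_mul, Finset.sum_mul]
  rw [Finset.sum_comm]
  simp_rw [Finset.sum_comm (s := (Finset.univ : Finset (Fin n → Fin 4))), mul_assoc,
    ← Finset.mul_sum, sum_pauli_mul_pauli]
  simp only [ite_and, mul_ite, mul_zero]
  simp [mul_comm]

/-- Parseval: pair the Pauli expansion of `A` with `B`. -/
theorem sum_crossChar {n : ℕ} (A B : Op n) :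
    ∑ p, crossChar A B p = 2 ^ n * (A * B).trace := by
  have h := congrArg (fun X : Op n => (B * X).trace) (sum_trace_mul_pauli_smul A)
  simp only [Finset.mul_sum, Matrix.trace_sum, Matrix.mul_smul, Matrix.trace_smul,
    smul_eq_mul] at h
  rw [Matrix.trace_mul_comm A B, ← h]
  rfl

theorem trace_pauli_mul_pauli {n : ℕ} (p q : Fin n → Fin 4) :
    (pauli p * pauli q).trace = if p = q then 2 ^ n else 0 := by
  have h1 : ∀ a b : Fin 4, ∑ i, (pauli1 a * pauli1 b) i i = if a = b then 2 else 0 := by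
    intro a b
    fin_cases a <;> fin_cases b <;> simp [pauli1, Matrix.mul_apply] <;> norm_num
  simp only [Matrix.trace, Matrix.diag_apply, pauli_mul_apply]
  rw [sum_pi_prod (fun k i => (pauli1 (p k) * pauli1 (q k)) i i)]
  simp only [h1]
  rw [Finset.prod_ite_zero]
  simp [funext_iff]

/-! ### Clifford conjugation and diagonal Pauli operators -/

/-- Whether a Pauli operator is a product of `I`s and `Z`s. -/
def IsZType {n : ℕ} (p : Fin n → Fin 4) : Prop := ∀ k, p k = 0 ∨ p k = 3

theorem sum_pauli_diag_mul {n : ℕ} (p q : Fin n → Fin 4) [Decidable (p = q ∧ IsZType p)] :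
    ∑ s, pauli p s s * pauli q s s = if p = q ∧ IsZType p then 2 ^ n else 0 := by
  have h1 : ∀ a b : Fin 4, ∑ i, pauli1 a i i * pauli1 b i i =
      if a = b ∧ (a = 0 ∨ a = 3) then 2 else 0 := by
    intro a b
    fin_cases a <;> fin_cases b <;> simp [pauli1] <;> norm_num
  simp only [pauli, Matrix.of_apply, ← Finset.prod_mul_distrib]
  rw [sum_pi_prod (fun k i => pauli1 (p k) i i * pauli1 (q k) i i)]
  simp only [h1]
  rw [Finset.prod_ite_zero]
  simp [funext_iff, IsZType, forall_and]

theorem commSign_of_isZType {n : ℕ} {p q : Fin n → Fin 4} (hp : IsZType p) (hq : IsZType q) :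
    commSign p q = 1 := by
  refine Finset.prod_eq_one fun k _ => ?_
  rcases hp k with h | h <;> rcases hq k with h' | h' <;> simp [commSign1, h, h']

theorem pauli_mem_unitaryGroup {n : ℕ} (p : Fin n → Fin 4) :
    pauli p ∈ Matrix.unitaryGroup (Bits n) ℂ := by
  rw [Matrix.mem_unitaryGroup_iff, Matrix.star_eq_conjTranspose, pauli_conjTranspose, pauli_sq]

theorem unitary_mul_conjTranspose {n : ℕ} (U : Matrix.unitaryGroup (Bits n) ℂ) :
    (U : Op n) * (U : Op n).conjTranspose = 1 := Matrix.mem_unitaryGroup_iff.1 U.2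

theorem unitary_conjTranspose_mul {n : ℕ} (U : Matrix.unitaryGroup (Bits n) ℂ) :
    (U : Op n).conjTranspose * (U : Op n) = 1 := Matrix.mem_unitaryGroup_iff'.1 U.2

theorem conj_mul_conj {n : ℕ} (U : Matrix.unitaryGroup (Bits n) ℂ) (A B : Op n) :
    ((U : Op n) * A * (U : Op n).conjTranspose) * ((U : Op n) * B * (U : Op n).conjTranspose) =
      (U : Op n) * (A * B) * (U : Op n).conjTranspose := by
  calc _ = (U : Op n) * A * ((U : Op n).conjTranspose * (U : Op n)) * B *
        (U : Op n).conjTranspose := by simp only [Matrix.mul_assoc]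
    _ = _ := by rw [unitary_conjTranspose_mul]; simp only [Matrix.mul_assoc, Matrix.mul_one]

/-- Squaring removes the Pauli operators. The phase is therefore a sign, and quantities quadratic in
the image do not see it. -/
theorem sq_eq_one_of_conj {n : ℕ} {U : Matrix.unitaryGroup (Bits n) ℂ} {p q : Fin n → Fin 4}
    {c : ℂ} (h : (U : Op n) * pauli p * (U : Op n).conjTranspose = c • pauli q) : c ^ 2 = 1 := by
  have h1 := conj_mul_conj U (pauli p) (pauli p)
  rw [h, pauli_sq, Matrix.mul_one, unitary_mul_conjTranspose, Matrix.smul_mul, Matrix.mul_smul,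
    pauli_sq, smul_smul] at h1
  have h2 := congrFun (congrFun h1 0) 0
  simpa [pow_two] using h2

theorem exists_conj_pauli {n : ℕ} {U : Matrix.unitaryGroup (Bits n) ℂ} (hU : U ∈ cliffordGroup n)
    (p : Fin n → Fin 4) :
    ∃ (c : ℂ) (q : Fin n → Fin 4),
      (U : Op n) * pauli p * (U : Op n).conjTranspose = c • pauli q := by
  obtain ⟨k, q, h⟩ := (Subgroup.mem_normalizer_iff.1 hU ⟨pauli p, pauli_mem_unitaryGroup p⟩).1
    ⟨0, p, by simp⟩
  exact ⟨_, q, h⟩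

/-- The indicator of `U P U†` being diagonal, for `U` in the Clifford group. -/
def diagInd {n : ℕ} (U : Op n) (p : Fin n → Fin 4) : ℂ :=
  (2 ^ n : ℂ)⁻¹ * ∑ s, (U * pauli p * U.conjTranspose) s s ^ 2

open Classical in
theorem diagInd_of_conj {n : ℕ} {U : Matrix.unitaryGroup (Bits n) ℂ} {p q : Fin n → Fin 4}
    {c : ℂ} (h : (U : Op n) * pauli p * (U : Op n).conjTranspose = c • pauli q) :
    diagInd (U : Op n) p = if IsZType q then 1 else 0 := by
  simp only [diagInd, h, Matrix.smul_apply, smul_eq_mul, mul_pow, sq_eq_one_of_conj h, one_mul]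
  simp only [pow_two, sum_pauli_diag_mul, true_and]
  split_ifs <;> simp

theorem diagInd_zero {n : ℕ} (U : Matrix.unitaryGroup (Bits n) ℂ) :
    diagInd (U : Op n) 0 = 1 := by
  simp only [diagInd, pauli_zero, Matrix.mul_one, unitary_mul_conjTranspose]
  simp

theorem conj_apply {n : ℕ} (U A : Op n) (s : Bits n) :
    (U * A * U.conjTranspose) s s = (A * (U.conjTranspose * basisProj s * U)).trace := by
  have : (U * A * U.conjTranspose) s s = (basisProj s * (U * A * U.conjTranspose)).trace := by
    simp [basisProj, Matrix.trace_single_mul]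
  rw [this, ← Matrix.mul_assoc, Matrix.trace_mul_comm]
  simp only [← Matrix.mul_assoc]
  rw [Matrix.trace_mul_comm]
  simp only [← Matrix.mul_assoc]

theorem conj_basisProj_mul_self {n : ℕ} (U : Matrix.unitaryGroup (Bits n) ℂ) (s : Bits n) :
    ((U : Op n).conjTranspose * basisProj s * U) * ((U : Op n).conjTranspose * basisProj s * U) =
      (U : Op n).conjTranspose * basisProj s * U := by
  calc _ = (U : Op n).conjTranspose * basisProj s * ((U : Op n) * (U : Op n).conjTranspose) *
        basisProj s * U := by simp only [Matrix.mul_assoc]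
    _ = _ := by
      rw [unitary_mul_conjTranspose, Matrix.mul_one, Matrix.mul_assoc (U : Op n).conjTranspose]
      simp [basisProj]

theorem trace_conj_basisProj {n : ℕ} (U : Matrix.unitaryGroup (Bits n) ℂ) (s : Bits n) :
    ((U : Op n).conjTranspose * basisProj s * U).trace = 1 := by
  rw [Matrix.trace_mul_comm, ← Matrix.mul_assoc, unitary_mul_conjTranspose]
  simp [basisProj]

/-- For fixed `s` the diagonal entries are the Pauli coefficients of the rank-one projector
`U†|s⟩⟨s|U`, so Parseval gives `2 ^ n` for any unitary. For a Clifford this counts the Paulis made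
diagonal. -/
theorem sum_diagInd {n : ℕ} (U : Matrix.unitaryGroup (Bits n) ℂ) :
    ∑ p, diagInd (U : Op n) p = 2 ^ n := by
  simp only [diagInd, ← Finset.mul_sum]
  rw [Finset.sum_comm]
  have : ∀ s, ∑ p : Fin n → Fin 4,
      ((U : Op n) * pauli p * (U : Op n).conjTranspose) s s ^ 2 = 2 ^ n := by
    intro s
    have h := sum_crossChar ((U : Op n).conjTranspose * basisProj s * (U : Op n))
      ((U : Op n).conjTranspose * basisProj s * (U : Op n))
    rw [conj_basisProj_mul_self, trace_conj_basisProj, mul_one] at h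
    rw [← h]
    refine Finset.sum_congr rfl fun p _ => ?_
    rw [conj_apply, Matrix.trace_mul_comm, pow_two, crossChar]
  simp [this]

theorem diagInd_mul_self {n : ℕ} {U : Matrix.unitaryGroup (Bits n) ℂ} (hU : U ∈ cliffordGroup n)
    (p : Fin n → Fin 4) : diagInd (U : Op n) p * diagInd (U : Op n) p = diagInd (U : Op n) p := by
  classical
  obtain ⟨c, q, h⟩ := exists_conj_pauli hU p
  rw [diagInd_of_conj h]
  split_ifs <;> simp

theorem commSign_eq_of_conj {n : ℕ} {U : Matrix.unitaryGroup (Bits n) ℂ}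
    {p q p' q' : Fin n → Fin 4} {c c' : ℂ}
    (h : (U : Op n) * pauli p * (U : Op n).conjTranspose = c • pauli p')
    (h' : (U : Op n) * pauli q * (U : Op n).conjTranspose = c' • pauli q') :
    commSign p q = commSign p' q' := by
  have e1 := conj_mul_conj U (pauli p) (pauli q)
  have e2 := conj_mul_conj U (pauli q) (pauli p)
  rw [pauli_mul_comm, Matrix.mul_smul, Matrix.smul_mul, ← e2, h, h', Matrix.smul_mul,
    Matrix.mul_smul, smul_smul, Matrix.smul_mul, Matrix.mul_smul, smul_smul, smul_smul,
    pauli_mul_comm p' q', smul_smul] at e1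
  have e3 := congrArg (fun X : Op n => pauli p' * (pauli q' * X)) e1
  simp only [Matrix.mul_smul] at e3
  rw [← Matrix.mul_assoc (pauli q'), pauli_sq, Matrix.one_mul, pauli_sq] at e3
  have e4 := congrFun (congrFun e3 0) 0
  have hc := sq_eq_one_of_conj h
  have hc' := sq_eq_one_of_conj h'
  simp only [Matrix.smul_apply, Matrix.one_apply_eq, smul_eq_mul, mul_one] at e4
  -- The signs `c` and `c'` square to one, so the factor `c * c'` can be cancelled.
  have e5 : ((commSign p' q' : ℤ) : ℂ) = commSign p q := by
    linear_combination (c * c') * e4 - ((commSign p' q' : ℂ) - commSign p q) * (c ^ 2 * hc' + hc)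
  exact_mod_cast e5.symm

/-- Conjugation preserves commutation, and diagonal Paulis commute. -/
theorem diagInd_mul_of_anticomm {n : ℕ} {U : Matrix.unitaryGroup (Bits n) ℂ}
    (hU : U ∈ cliffordGroup n) {p q : Fin n → Fin 4} (hpq : commSign p q = -1) :
    diagInd (U : Op n) p * diagInd (U : Op n) q = 0 := by
  classical
  obtain ⟨c, p', h⟩ := exists_conj_pauli hU p
  obtain ⟨c', q', h'⟩ := exists_conj_pauli hU q
  rw [commSign_eq_of_conj h h'] at hpq
  rw [diagInd_of_conj h, diagInd_of_conj h']
  split_ifs with h1 h2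
  · rw [commSign_of_isZType h1 h2] at hpq
    norm_num at hpq
  all_goals simp

theorem diagInd_mul_right {n : ℕ} (U : Matrix.unitaryGroup (Bits n) ℂ)
    {V : Matrix.unitaryGroup (Bits n) ℂ} {p q : Fin n → Fin 4} {c : ℂ}
    (h : (V : Op n) * pauli p * (V : Op n).conjTranspose = c • pauli q) :
    diagInd ((U * V : Matrix.unitaryGroup (Bits n) ℂ) : Op n) p = diagInd (U : Op n) q := by
  have e : ((U * V : Matrix.unitaryGroup (Bits n) ℂ) : Op n) * pauli p *
      ((U * V : Matrix.unitaryGroup (Bits n) ℂ) : Op n).conjTranspose =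
      c • ((U : Op n) * pauli q * (U : Op n).conjTranspose) := by
    rw [Submonoid.coe_mul, Matrix.conjTranspose_mul, ← Matrix.smul_mul, ← Matrix.mul_smul, ← h]
    simp only [Matrix.mul_assoc]
  simp only [diagInd, e, Matrix.smul_apply, smul_eq_mul, mul_pow, sq_eq_one_of_conj h, one_mul]

theorem sum_conj_pauli_mul {n : ℕ} {U : Matrix.unitaryGroup (Bits n) ℂ}
    (hU : U ∈ cliffordGroup n) (p q : Fin n → Fin 4) :
    ∑ s, ((U : Op n) * pauli p * (U : Op n).conjTranspose) s s *
      ((U : Op n) * pauli q * (U : Op n).conjTranspose) s s =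
      if p = q then 2 ^ n * diagInd (U : Op n) p else 0 := by
  classical
  split_ifs with hpq
  · subst hpq
    simp only [diagInd, pow_two]
    field_simp
  · obtain ⟨c, p', h⟩ := exists_conj_pauli hU p
    obtain ⟨c', q', h'⟩ := exists_conj_pauli hU q
    -- Conjugation preserves `Tr(PQ)`, which vanishes for distinct Paulis but not for two nonzero
    -- multiples of the same one.
    have hne : p' ≠ q' := by
      rintro rfl
      have e1 := conj_mul_conj U (pauli p) (pauli q)
      rw [h, h', Matrix.smul_mul, Matrix.mul_smul, pauli_sq, smul_smul] at e1
      have e2 := congrArg Matrix.trace e1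
      rw [Matrix.trace_mul_comm, ← Matrix.mul_assoc, unitary_conjTranspose_mul, Matrix.one_mul,
        trace_pauli_mul_pauli, if_neg hpq, Matrix.trace_smul] at e2
      have hc := sq_eq_one_of_conj h
      have hc' := sq_eq_one_of_conj h'
      have hc0 : c ≠ 0 := by rintro rfl; simp at hc
      have hc0' : c' ≠ 0 := by rintro rfl; simp at hc'
      simp [Matrix.trace_one, hc0, hc0'] at e2
    have : ∀ s, (c * pauli p' s s) * (c' * pauli q' s s) =
        c * c' * (pauli p' s s * pauli q' s s) := fun s => by ring
    simp only [h, h', Matrix.smul_apply, smul_eq_mul, this, ← Finset.mul_sum,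
      sum_pauli_diag_mul, hne, false_and, if_false, mul_zero]

/-- Expand `A` and `B` in Paulis; the diagonals of the conjugated Paulis are orthogonal, so only
equal pairs survive. -/
theorem sum_conj_diag_mul {n : ℕ} {U : Matrix.unitaryGroup (Bits n) ℂ}
    (hU : U ∈ cliffordGroup n) (A B : Op n) :
    ∑ s, ((U : Op n) * A * (U : Op n).conjTranspose) s s *
      ((U : Op n) * B * (U : Op n).conjTranspose) s s =
      (2 ^ n : ℂ)⁻¹ * ∑ p, diagInd (U : Op n) p * crossChar A B p := by
  have key : ∀ A : Op n, ∀ s, ((U : Op n) * A * (U : Op n).conjTranspose) s s =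
      (2 ^ n : ℂ)⁻¹ * ∑ p : Fin n → Fin 4, (A * pauli p).trace *
        ((U : Op n) * pauli p * (U : Op n).conjTranspose) s s := by
    intro A s
    have h := congrArg (fun X : Op n => ((U : Op n) * X * (U : Op n).conjTranspose) s s)
      (sum_trace_mul_pauli_smul A)
    simp only [Matrix.mul_sum, Matrix.sum_mul, Matrix.sum_apply, Matrix.mul_smul, Matrix.smul_mul,
      Matrix.smul_apply, smul_eq_mul] at h
    rw [h, inv_mul_cancel_left₀ (by positivity)]
  have e : ∀ s, ((U : Op n) * A * (U : Op n).conjTranspose) s s *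
      ((U : Op n) * B * (U : Op n).conjTranspose) s s =
      (2 ^ n : ℂ)⁻¹ * (2 ^ n : ℂ)⁻¹ * ∑ p, ∑ q, ((A * pauli p).trace * (B * pauli q).trace) *
        (((U : Op n) * pauli p * (U : Op n).conjTranspose) s s *
          ((U : Op n) * pauli q * (U : Op n).conjTranspose) s s) := by
    intro s
    rw [key A, key B, mul_mul_mul_comm, Finset.sum_mul_sum]
    congr 1
    exact Finset.sum_congr rfl fun p _ => Finset.sum_congr rfl fun q _ => by ring
  simp only [e, ← Finset.mul_sum]
  rw [Finset.sum_comm]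
  simp_rw [Finset.sum_comm (s := (Finset.univ : Finset (Bits n))), ← Finset.mul_sum,
    sum_conj_pauli_mul hU]
  rw [mul_assoc]
  congr 1
  rw [Finset.mul_sum]
  refine Finset.sum_congr rfl fun p _ => ?_
  simp only [mul_ite, mul_zero, Finset.sum_ite_eq, Finset.mem_univ, if_true, crossChar]
  field_simp

/-! ### Pauli rotations and transitivity of the Clifford group -/

/-- The rotation `exp(iπP/4) = (1 + iP)/√2` about a Pauli operator. -/
def pauliRotation {n : ℕ} (p : Fin n → Fin 4) : Op n :=
  ((Real.sqrt 2 : ℂ)⁻¹) • (1 + Complex.I • pauli p)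

theorem inv_sqrt_two_mul_self : ((Real.sqrt 2 : ℂ)⁻¹) * ((Real.sqrt 2 : ℂ)⁻¹) = 1 / 2 := by
  rw [← mul_inv, ← Complex.ofReal_mul, Real.mul_self_sqrt (by norm_num)]
  norm_num

theorem pauliRotation_conjTranspose {n : ℕ} (p : Fin n → Fin 4) :
    (pauliRotation p).conjTranspose = ((Real.sqrt 2 : ℂ)⁻¹) • (1 - Complex.I • pauli p) := by
  simp [pauliRotation, Matrix.conjTranspose_smul, pauli_conjTranspose, sub_eq_add_neg]

theorem pauliRotation_mul_conjTranspose {n : ℕ} (p : Fin n → Fin 4) :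
    pauliRotation p * (pauliRotation p).conjTranspose = 1 := by
  rw [pauliRotation_conjTranspose, pauliRotation, Matrix.smul_mul, Matrix.mul_smul, smul_smul,
    inv_sqrt_two_mul_self]
  simp only [Matrix.add_mul, Matrix.mul_sub, Matrix.one_mul, Matrix.mul_one, Matrix.smul_mul,
    Matrix.mul_smul, pauli_sq]
  match_scalars
  · linear_combination (-1 / 2 : ℂ) * Complex.I_sq
  · ring

theorem pauliRotation_conj_of_commute {n : ℕ} {p : Fin n → Fin 4} {A : Op n}
    (h : pauli p * A = A * pauli p) :
    pauliRotation p * A * (pauliRotation p).conjTranspose = A := by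
  have : pauliRotation p * A = A * pauliRotation p := by
    simp [pauliRotation, Matrix.add_mul, Matrix.mul_add, h]
  rw [this, Matrix.mul_assoc, pauliRotation_mul_conjTranspose, Matrix.mul_one]

theorem pauliRotation_conj_of_anticommute {n : ℕ} {p : Fin n → Fin 4} {A : Op n}
    (h : A * pauli p = -(pauli p * A)) :
    pauliRotation p * A * (pauliRotation p).conjTranspose = Complex.I • (pauli p * A) := by
  rw [pauliRotation_conjTranspose, pauliRotation, Matrix.smul_mul, Matrix.smul_mul,
    Matrix.mul_smul, smul_smul, inv_sqrt_two_mul_self]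
  have h2 : pauli p * A * pauli p = -A := by
    rw [Matrix.mul_assoc, h, Matrix.mul_neg, ← Matrix.mul_assoc, pauli_sq, Matrix.one_mul]
  simp only [Matrix.add_mul, Matrix.mul_sub, Matrix.one_mul, Matrix.mul_one, Matrix.smul_mul,
    Matrix.mul_smul, h, h2]
  match_scalars
  · linear_combination (1 / 2 : ℂ) * Complex.I_sq
  · ring

/-- `pauliRotation` as a unitary. -/
def pauliRotationU {n : ℕ} (p : Fin n → Fin 4) : Matrix.unitaryGroup (Bits n) ℂ :=
  ⟨pauliRotation p, Matrix.mem_unitaryGroup_iff.2 (pauliRotation_mul_conjTranspose p)⟩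

theorem pauliRotationU_mem {n : ℕ} (p : Fin n → Fin 4) :
    pauliRotationU p ∈ cliffordGroup n := by
  have := finite_pauliGroup n
  have : Finite (pauliGroup n : Set (Matrix.unitaryGroup (Bits n) ℂ)) := this
  -- The Pauli group is finite, so mapping it into itself is enough to normalize it.
  refine Subgroup.mem_normalizer_fintype ?_
  rintro W ⟨k, q, hW⟩
  have e : ((pauliRotationU p * W * (pauliRotationU p)⁻¹ : Matrix.unitaryGroup (Bits n) ℂ) : Op n)
      = pauliRotation p * (W : Op n) * (pauliRotation p).conjTranspose := rfl
  have hpq := pauli_mul_comm q p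
  rcases commSign_eq_or q p with h | h
  · refine ⟨k, q, ?_⟩
    rw [e, hW, Matrix.mul_smul, Matrix.smul_mul, pauliRotation_conj_of_commute]
    rw [hpq, h]
    simp
  · obtain ⟨l, r, hr⟩ := pauli_mul p q
    refine ⟨k + 1 + l, r, ?_⟩
    rw [e, hW, Matrix.mul_smul, Matrix.smul_mul, pauliRotation_conj_of_anticommute, hr, smul_smul,
      smul_smul, pow_add, pow_add, pow_one, mul_assoc]
    rw [hpq, h]
    simp

/-- Rotate about the Pauli `m` proportional to `q r`: it commutes with `p`, because `q` and `r` do,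
and anticommutes with `q`, so `q` goes to `i m q`, a multiple of `r`. -/
theorem exists_clifford_step {n : ℕ} {p q r : Fin n → Fin 4} (hpq : commSign p q = 1)
    (hpr : commSign p r = 1) (hqr : commSign q r = -1) :
    ∃ V ∈ cliffordGroup n, (V : Op n) * pauli p * (V : Op n).conjTranspose = pauli p ∧
      ∃ c : ℂ, (V : Op n) * pauli q * (V : Op n).conjTranspose = c • pauli r := by
  obtain ⟨k, m, hm⟩ := pauli_mul q r
  have hm' : pauli m = (Complex.I ^ k)⁻¹ • (pauli q * pauli r) := by
    rw [hm, smul_smul, inv_mul_cancel₀ (pow_ne_zero _ Complex.I_ne_zero), one_smul]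
  have e1 := pauli_mul_comm p q
  have e2 := pauli_mul_comm p r
  have e3 := pauli_mul_comm q r
  rw [hpq, Int.cast_one, one_smul] at e1
  rw [hpr, Int.cast_one, one_smul] at e2
  rw [hqr, Int.cast_neg, Int.cast_one, neg_smul, one_smul] at e3
  refine ⟨pauliRotationU m, pauliRotationU_mem m, pauliRotation_conj_of_commute ?_,
    Complex.I * (-(Complex.I ^ k)⁻¹), ?_⟩
  · rw [hm', Matrix.smul_mul, Matrix.mul_smul, Matrix.mul_assoc, ← e2, ← Matrix.mul_assoc, ← e1,
      Matrix.mul_assoc]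
  · have h4 : pauli m * pauli q = (-(Complex.I ^ k)⁻¹) • pauli r := by
      rw [hm', e3, smul_neg, Matrix.neg_mul, Matrix.smul_mul, Matrix.mul_assoc, pauli_sq,
        Matrix.mul_one, neg_smul]
    have h5 : pauli q * pauli m = (Complex.I ^ k)⁻¹ • pauli r := by
      rw [hm', Matrix.mul_smul, ← Matrix.mul_assoc, pauli_sq, Matrix.one_mul]
    rw [mul_smul, ← h4]
    refine pauliRotation_conj_of_anticommute ?_
    rw [h4, h5, neg_smul, neg_neg]

/-- The stabilizer of a Pauli operator `p` in the Clifford group acts transitively (up to phases)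
on the Pauli operators other than `1` and `p` that commute with `p`. -/
theorem exists_clifford_conj {n : ℕ} {p q q' : Fin n → Fin 4} (hq : q ≠ 0) (hq' : q' ≠ 0)
    (hpq : p ≠ q) (hpq' : p ≠ q') (h : commSign p q = 1) (h' : commSign p q' = 1) :
    ∃ V ∈ cliffordGroup n, (V : Op n) * pauli p * (V : Op n).conjTranspose = pauli p ∧
      ∃ c : ℂ, (V : Op n) * pauli q * (V : Op n).conjTranspose = c • pauli q' := by
  -- The Paulis `q` and `q'` may commute, so they are linked through an `r` that anticommutes with
  -- both: `q → r → q'`.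
  obtain ⟨r, h1, h2, h3⟩ := exists_commSign hq hq' hpq hpq'
  obtain ⟨V, hV, hVp, c, hVq⟩ := exists_clifford_step h h1 h2
  rw [commSign_comm] at h3
  obtain ⟨W, hW, hWp, c', hWq⟩ := exists_clifford_step h1 h' h3
  have e : ∀ A : Op n, ((W * V : Matrix.unitaryGroup (Bits n) ℂ) : Op n) * A *
      ((W * V : Matrix.unitaryGroup (Bits n) ℂ) : Op n).conjTranspose =
      (W : Op n) * ((V : Op n) * A * (V : Op n).conjTranspose) * (W : Op n).conjTranspose := by
    intro A
    rw [Submonoid.coe_mul, Matrix.conjTranspose_mul]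
    simp only [Matrix.mul_assoc]
  refine ⟨W * V, mul_mem hW hV, ?_, c * c', ?_⟩
  · rw [e, hVp, hWp]
  · rw [e, hVq, Matrix.mul_smul, Matrix.smul_mul, hWq, smul_smul]

/-! ### Averages over the Clifford group modulo phases -/

instance normal_phases (n : ℕ) : (phases n).Normal := by
  constructor
  rintro U ⟨c, hU⟩ V
  refine ⟨c, ?_⟩
  have : (((V * U * V⁻¹ : cliffordGroup n) : Matrix.unitaryGroup (Bits n) ℂ) : Op n) =
    ((V : Matrix.unitaryGroup (Bits n) ℂ) : Op n) * ((U : Matrix.unitaryGroup (Bits n) ℂ) : Op n) *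
    ((V : Matrix.unitaryGroup (Bits n) ℂ) : Op n).conjTranspose := rfl
  rw [this, hU, Matrix.mul_smul, Matrix.smul_mul, Matrix.mul_one, unitary_mul_conjTranspose]

/-- Right translation permutes the quotient; the chosen representatives change only by phases, which
`F` ignores. -/
theorem sum_projClifford_mul_right {n : ℕ} {F : cliffordGroup n → ℂ}
    (hF : ∀ U, ∀ h ∈ phases n, F (U * h) = F U) (V : cliffordGroup n) :
    ∑ g : ProjClifford n, F (Quotient.out g * V) = ∑ g : ProjClifford n, F (Quotient.out g) := by
  refine Fintype.sum_equiv (Equiv.mulRight (V : ProjClifford n)) _ _ fun g => ?_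
  have hg : (Equiv.mulRight (V : ProjClifford n)) g =
      ((Quotient.out g * V : cliffordGroup n) : ProjClifford n) := by
    rw [Equiv.coe_mulRight, QuotientGroup.mk_mul, QuotientGroup.out_eq']
  obtain ⟨h, hh⟩ := QuotientGroup.mk_out_eq_mul (phases n) (Quotient.out g * V)
  rw [hg]
  erw [hh]
  rw [hF _ _ h.2]

/-- The probability that two Pauli operators are simultaneously mapped to diagonal ones by a
random Clifford unitary. -/
def diagProb {n : ℕ} (p q : Fin n → Fin 4) : ℂ :=
  (Fintype.card (ProjClifford n) : ℂ)⁻¹ * ∑ g : ProjClifford n,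
    diagInd (cliffordEnsemble n g : Op n) p * diagInd (cliffordEnsemble n g : Op n) q

theorem cliffordEnsemble_mem {n : ℕ} (g : ProjClifford n) :
    cliffordEnsemble n g ∈ cliffordGroup n := (Quotient.out g : cliffordGroup n).2

theorem diagInd_mul_phase {n : ℕ} (U : cliffordGroup n) {h : cliffordGroup n}
    (hh : h ∈ phases n) (p : Fin n → Fin 4) :
    diagInd (((U * h : cliffordGroup n) : Matrix.unitaryGroup (Bits n) ℂ) : Op n) p =
      diagInd ((U : Matrix.unitaryGroup (Bits n) ℂ) : Op n) p := by
  obtain ⟨a, ha⟩ := hh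
  refine diagInd_mul_right (c := 1) _ ?_
  have h1 : ((h : Matrix.unitaryGroup (Bits n) ℂ) : Op n) * pauli p =
      pauli p * ((h : Matrix.unitaryGroup (Bits n) ℂ) : Op n) := by
    rw [ha, Matrix.smul_mul, Matrix.mul_smul, Matrix.one_mul, Matrix.mul_one]
  rw [h1, Matrix.mul_assoc, unitary_mul_conjTranspose, Matrix.mul_one, one_smul]

theorem diagProb_conj {n : ℕ} {V : Matrix.unitaryGroup (Bits n) ℂ} (hV : V ∈ cliffordGroup n)
    {p p' q q' : Fin n → Fin 4} {c c' : ℂ}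
    (hp : (V : Op n) * pauli p * (V : Op n).conjTranspose = c • pauli p')
    (hq : (V : Op n) * pauli q * (V : Op n).conjTranspose = c' • pauli q') :
    diagProb p q = diagProb p' q' := by
  have h := sum_projClifford_mul_right (F := fun U =>
    diagInd ((U : Matrix.unitaryGroup (Bits n) ℂ) : Op n) p *
      diagInd ((U : Matrix.unitaryGroup (Bits n) ℂ) : Op n) q)
    (fun U h hh => by simp only [diagInd_mul_phase U hh]) ⟨V, hV⟩
  simp only [Subgroup.coe_mul, diagInd_mul_right _ hp, diagInd_mul_right _ hq] at h
  unfold diagProb cliffordEnsemble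
  rw [h]

theorem diagProb_zero_zero {n : ℕ} : diagProb (0 : Fin n → Fin 4) 0 = 1 := by
  simp [diagProb, diagInd_zero]

theorem diagProb_comm {n : ℕ} (p q : Fin n → Fin 4) : diagProb p q = diagProb q p := by
  simp [diagProb, mul_comm]

theorem diagProb_self {n : ℕ} (p : Fin n → Fin 4) : diagProb p p = diagProb p 0 := by
  simp [diagProb, diagInd_zero, diagInd_mul_self (cliffordEnsemble_mem _)]

/-- Every ensemble member makes exactly `2 ^ n` Paulis diagonal. -/
theorem sum_diagProb {n : ℕ} (p : Fin n → Fin 4) : ∑ q, diagProb p q = 2 ^ n * diagProb p 0 := by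
  simp only [diagProb, ← Finset.mul_sum]
  rw [Finset.sum_comm]
  simp only [← Finset.mul_sum, sum_diagInd, diagInd_zero, ← Finset.sum_mul]
  ring

theorem diagProb_of_anticomm {n : ℕ} {p q : Fin n → Fin 4} (h : commSign p q = -1) :
    diagProb p q = 0 := by
  simp [diagProb, diagInd_mul_of_anticomm (cliffordEnsemble_mem _) h]

theorem diagProb_eq_of_comm {n : ℕ} {p q q' : Fin n → Fin 4} (hq : q ≠ 0) (hq' : q' ≠ 0)
    (hpq : p ≠ q) (hpq' : p ≠ q') (h : commSign p q = 1) (h' : commSign p q' = 1) :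
    diagProb p q = diagProb p q' := by
  obtain ⟨V, hV, h1, c, h2⟩ := exists_clifford_conj hq hq' hpq hpq' h h'
  exact diagProb_conj hV (c := 1) (by rw [h1, one_smul]) h2

theorem four_pow_eq (n : ℕ) : (4 : ℂ) ^ n = (2 ^ n) ^ 2 := by
  rw [← pow_mul, mul_comm, pow_mul]; norm_num

theorem two_pow_add_ne_zero (n k : ℕ) : (2 : ℂ) ^ n + k ≠ 0 := by
  exact_mod_cast (by positivity : 2 ^ n + k ≠ 0)

/-- The identity is always diagonal and the other `d² - 1` Paulis share one value `x` by
transitivity, so `1 + (d² - 1)x = d`. -/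
theorem diagProb_zero {n : ℕ} {p : Fin n → Fin 4} (hp : p ≠ 0) :
    diagProb p 0 = 1 / (2 ^ n + 1) := by
  have h1 := sum_diagProb (0 : Fin n → Fin 4)
  rw [diagProb_zero_zero, ← Finset.add_sum_erase _ _ (Finset.mem_univ 0), diagProb_zero_zero,
    Finset.sum_congr rfl (g := fun _ => diagProb 0 p) (fun q hq => diagProb_eq_of_comm
      (Finset.ne_of_mem_erase hq) hp (Finset.ne_of_mem_erase hq).symm hp.symm
      (commSign_zero_left _) (commSign_zero_left _)), Finset.sum_const,
    Finset.card_erase_of_mem (Finset.mem_univ _)] at h1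
  have hc : ((Finset.univ : Finset (Fin n → Fin 4)).card - 1 : ℕ) = 4 ^ n - 1 := by simp
  have h4 : 1 ≤ 4 ^ n := Nat.one_le_pow _ _ (by norm_num)
  rw [hc, nsmul_eq_mul, Nat.cast_sub h4, Nat.cast_pow] at h1
  push_cast at h1
  rw [four_pow_eq] at h1
  -- Cancelling `d - 1` needs `d ≠ 1`, which a nonidentity Pauli guarantees.
  have hn : n ≠ 0 := by
    rintro rfl
    exact hp (Subsingleton.elim _ _)
  have h2 : (2 : ℂ) ^ n - 1 ≠ 0 := by
    have : (1 : ℕ) < 2 ^ n := Nat.one_lt_two_pow hn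
    intro h
    have h' : (2 : ℂ) ^ n = 1 := by linear_combination h
    norm_cast at h'
    omega
  have h3 := two_pow_add_ne_zero n 1
  rw [Nat.cast_one] at h3
  rw [diagProb_comm]
  field_simp
  apply mul_left_cancel₀ h2
  linear_combination h1

/-- Half of all Paulis commute with `p`, because the signs of `p` sum to zero. -/
theorem card_comm {n : ℕ} {p : Fin n → Fin 4} (hp : p ≠ 0) :
    ((Finset.univ.filter fun q => commSign p q = 1).card : ℂ) = (2 ^ n) ^ 2 / 2 := by
  have h1 : (∑ q, (1 + commSign p q) : ℤ) =
      2 * (Finset.univ.filter fun q => commSign p q = 1).card := by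
    rw [Finset.card_filter, Nat.cast_sum, Finset.mul_sum]
    refine Finset.sum_congr rfl fun q _ => ?_
    rcases commSign_eq_or p q with h | h <;> simp [h]
  rw [Finset.sum_add_distrib, sum_commSign, if_neg hp] at h1
  have h5 : ∑ _r : Fin n → Fin 4, (1 : ℤ) = 4 ^ n := by simp
  rw [h5] at h1
  have h2 : (4 : ℂ) ^ n = 2 * (Finset.univ.filter fun q => commSign p q = 1).card := by
    exact_mod_cast (by linarith : (4 : ℤ) ^ n =
      2 * (Finset.univ.filter fun q => commSign p q = 1).card)
  rw [← four_pow_eq, h2]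
  ring

/-- Among the `d²/2` Paulis commuting with `p`, the identity and `p` each contribute `1/(d+1)` and
the others share one value `x`. Thus `2/(d+1) + (d²/2 - 2)x = d/(d+1)`. -/
theorem diagProb_of_comm {n : ℕ} {p q : Fin n → Fin 4} (hp : p ≠ 0) (hq : q ≠ 0) (hpq : p ≠ q)
    (h : commSign p q = 1) : diagProb p q = 2 / ((2 ^ n + 1) * (2 ^ n + 2)) := by
  set S := Finset.univ.filter fun q => commSign p q = 1 with hS
  have h1 := sum_diagProb p
  have hsplit : ∑ q, diagProb p q = ∑ q ∈ S, diagProb p q := by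
    rw [hS, Finset.sum_filter]
    refine Finset.sum_congr rfl fun q _ => ?_
    rcases commSign_eq_or p q with h | h
    · simp [h]
    · simp [h, diagProb_of_anticomm h]
  have m0 : (0 : Fin n → Fin 4) ∈ S := by
    simp [hS, commSign_comm p 0, commSign_zero_left]
  have mp : p ∈ S.erase 0 := by simp [hS, hp, commSign_self]
  have mq : q ∈ (S.erase 0).erase p := by simp [hS, hq, hpq.symm, h]
  rw [hsplit, ← Finset.add_sum_erase _ _ m0, ← Finset.add_sum_erase _ _ mp, diagProb_self,
    Finset.sum_congr rfl (g := fun _ => diagProb p q) (fun r hr => by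
      simp only [Finset.mem_erase, hS, Finset.mem_filter, Finset.mem_univ, true_and] at hr
      exact diagProb_eq_of_comm hr.2.1 hq hr.1.symm hpq hr.2.2 h), Finset.sum_const,
    nsmul_eq_mul, diagProb_zero hp] at h1
  have hc1 := Finset.card_erase_add_one mp
  have hc2 := Finset.card_erase_add_one m0
  have hc : ((((S.erase 0).erase p).card : ℕ) : ℂ) = (2 ^ n) ^ 2 / 2 - 2 := by
    rw [← card_comm hp, ← hc2, ← hc1]
    push_cast
    ring
  -- The coefficient `d²/2 - 2` vanishes for one qubit; the presence of `q` excludes this case.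
  have hpos : ((((S.erase 0).erase p).card : ℕ) : ℂ) ≠ 0 := by
    exact_mod_cast (Finset.card_pos.2 ⟨q, mq⟩).ne'
  rw [hc] at h1 hpos
  have h3 := two_pow_add_ne_zero n 1
  have h4 := two_pow_add_ne_zero n 2
  push_cast at h3 h4
  apply mul_left_cancel₀ hpos
  field_simp at h1 ⊢
  linear_combination ((2:ℂ)^n + 2) * h1

/-! ### The cross moment operator and the measurement channel -/

/-- The four tensor factors separate the trace, and the double sum over `s` and `t` is then a
square. -/
theorem trace_crossMoment_mul {n : ℕ} {ι : Type*} [Fintype ι]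
    (𝒰 : ι → Matrix.unitaryGroup (Bits n) ℂ) (A τ : Op n) :
    (crossMoment 𝒰 * tensorSq (A ⊗ₖ τ)).trace = (Fintype.card ι : ℂ)⁻¹ *
      ∑ i, (∑ s, ((𝒰 i : Op n) * A * (𝒰 i : Op n).conjTranspose) s s *
        ((𝒰 i : Op n) * τ * (𝒰 i : Op n).conjTranspose) s s) ^ 2 := by
  simp only [crossMoment, avg, tensorSq, Matrix.sum_mul, Matrix.smul_mul, Matrix.trace_sum,
    Matrix.trace_smul, ← Matrix.mul_kronecker_mul, Matrix.trace_kronecker, conj_apply,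
    smul_eq_mul, ← Finset.mul_sum, pow_two, Finset.sum_mul_sum]
  congr 1
  simp_rw [Finset.sum_comm (t := (Finset.univ : Finset ι))]
  refine Finset.sum_congr rfl fun i _ => Finset.sum_congr rfl fun s _ => ?_
  rw [Finset.mul_sum]
  refine Finset.sum_congr rfl fun t _ => ?_
  simp only [Matrix.trace_mul_comm A, Matrix.trace_mul_comm τ]

theorem trace_measurementChannel_mul {n : ℕ} {ι : Type*} [Fintype ι]
    (𝒰 : ι → Matrix.unitaryGroup (Bits n) ℂ) (A τ : Op n) :
    (measurementChannel 𝒰 A * τ).trace = (Fintype.card ι : ℂ)⁻¹ *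
      ∑ i, ∑ s, ((𝒰 i : Op n) * A * (𝒰 i : Op n).conjTranspose) s s *
        ((𝒰 i : Op n) * τ * (𝒰 i : Op n).conjTranspose) s s := by
  have h : measurementChannel 𝒰 A = avg 𝒰 fun U =>
    ∑ s, (U * A * U.conjTranspose) s s • (U.conjTranspose * basisProj s * U) := rfl
  rw [h]
  simp only [avg, Matrix.sum_mul, Matrix.smul_mul, Matrix.trace_sum, Matrix.trace_smul,
    smul_eq_mul]
  simp only [conj_apply _ τ, Matrix.trace_mul_comm τ]

/-- Test against every `τ`: the Pauli coefficient at `p` is multiplied by `diagProb p 0`, which is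
`1` at the identity and `1/(d+1)` elsewhere. This is a depolarizing channel. -/
theorem measurementChannel_clifford {n : ℕ} (A : Op n) :
    measurementChannel (cliffordEnsemble n) A = (2 ^ n + 1 : ℂ)⁻¹ • (A + A.trace • (1 : Op n)) := by
  rw [Matrix.ext_iff_trace_mul_right]
  intro τ
  rw [trace_measurementChannel_mul]
  simp only [sum_conj_diag_mul (cliffordEnsemble_mem _), ← Finset.mul_sum]
  rw [Finset.sum_comm]
  simp only [← Finset.sum_mul]
  have h1 : ∀ p : Fin n → Fin 4, ∑ g : ProjClifford n, diagInd (cliffordEnsemble n g : Op n) p =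
      Fintype.card (ProjClifford n) * diagProb p 0 := by
    intro p
    simp [diagProb, diagInd_zero]
  have h3 := two_pow_add_ne_zero n 1
  rw [Nat.cast_one] at h3
  have h2 : ∀ p : Fin n → Fin 4, diagProb p 0 * crossChar A τ p = (2 ^ n + 1 : ℂ)⁻¹ *
      (crossChar A τ p + if p = 0 then 2 ^ n * (A.trace * τ.trace) else 0) := by
    intro p
    by_cases hp : p = 0
    · subst hp
      rw [diagProb_zero_zero, if_pos rfl, crossChar, pauli_zero, Matrix.mul_one, Matrix.mul_one]
      field_simp
      ring
    · rw [diagProb_zero hp, if_neg hp, add_zero, one_div]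
  have hcard : (Fintype.card (ProjClifford n) : ℂ) ≠ 0 := by
    exact_mod_cast Fintype.card_ne_zero
  simp only [h1, mul_assoc, h2, ← Finset.mul_sum, Finset.sum_add_distrib, sum_crossChar]
  simp only [Finset.sum_ite_eq', Finset.mem_univ, if_true, Matrix.smul_mul, Matrix.trace_smul,
    Matrix.add_mul, Matrix.trace_add, Matrix.one_mul, smul_eq_mul]
  field_simp

theorem isUnit_measurementChannel_clifford (n : ℕ) :
    IsUnit (measurementChannel (cliffordEnsemble n)) ∧
    ∀ O : Op n, O.trace = 0 → reconstruction (cliffordEnsemble n) O = (2 ^ n + 1 : ℂ) • O := by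
  have h3 := two_pow_add_ne_zero n 1
  rw [Nat.cast_one] at h3
  let N : Module.End ℂ (Op n) :=
    { toFun := fun A => (2 ^ n + 1 : ℂ) • A - A.trace • (1 : Op n)
      map_add' := fun A B => by
        simp only [smul_add, Matrix.trace_add, add_smul]; abel
      map_smul' := fun c A => by
        simp only [Matrix.trace_smul, RingHom.id_apply, smul_sub, smul_smul, smul_eq_mul,
          mul_comm] }
  have htr : (1 : Op n).trace = 2 ^ n := by simp [Matrix.trace_one]
  have hMN : measurementChannel (cliffordEnsemble n) * N = 1 := by
    refine LinearMap.ext fun A => ?_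
    change measurementChannel (cliffordEnsemble n)
      ((2 ^ n + 1 : ℂ) • A - A.trace • (1 : Op n)) = A
    rw [measurementChannel_clifford]
    simp only [Matrix.trace_sub, Matrix.trace_smul, smul_eq_mul, htr]
    match_scalars <;> field_simp
    ring
  have hNM : N * measurementChannel (cliffordEnsemble n) = 1 := by
    refine LinearMap.ext fun A => ?_
    change (2 ^ n + 1 : ℂ) • measurementChannel (cliffordEnsemble n) A -
      (measurementChannel (cliffordEnsemble n) A).trace • (1 : Op n) = A
    rw [measurementChannel_clifford]
    simp only [Matrix.trace_add, Matrix.trace_smul, smul_eq_mul, htr]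
    match_scalars <;> field_simp
    ring
  refine ⟨⟨⟨_, N, hMN, hNM⟩, rfl⟩, fun O hO => ?_⟩
  have : reconstruction (cliffordEnsemble n) = N :=
    Ring.inverse_unit ⟨_, N, hMN, hNM⟩
  rw [this]
  change (2 ^ n + 1 : ℂ) • O - O.trace • (1 : Op n) = _
  rw [hO, zero_smul, sub_zero]

/-! ### The exact variance formula -/

/-- Conjugating `A` by `P` multiplies its Pauli coefficients by the commutation signs; then apply
Parseval to `P A P` and `B`. -/
theorem sum_commSign_crossChar {n : ℕ} (A B : Op n) (p : Fin n → Fin 4) :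
    ∑ q, (commSign p q : ℂ) * crossChar A B q = 2 ^ n * twistedCrossChar A B p := by
  have h := sum_crossChar (pauli p * A * pauli p) B
  have h1 : (pauli p * A * pauli p * B).trace = twistedCrossChar A B p := by
    rw [twistedCrossChar, Matrix.mul_assoc, Matrix.mul_assoc, Matrix.trace_mul_comm,
      Matrix.mul_assoc, Matrix.mul_assoc, Matrix.mul_assoc, Matrix.mul_assoc]
  rw [← h1, ← h]
  refine Finset.sum_congr rfl fun q _ => ?_
  have h2 : (pauli p * A * pauli p * pauli q).trace = commSign p q * (A * pauli q).trace := by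
    rw [Matrix.mul_assoc, Matrix.mul_assoc, Matrix.trace_mul_comm, Matrix.mul_assoc,
      pauli_mul_comm, Matrix.smul_mul, Matrix.mul_assoc, pauli_sq, Matrix.mul_one,
      Matrix.mul_smul, Matrix.trace_smul, smul_eq_mul]
  rw [crossChar, crossChar, h2, mul_assoc]

/-- Off the diagonal and away from the identity, `diagProb p q` is `(1 + commSign p q) /
((d+1)(d+2))`. On the diagonal it is `(2 + d) / ((d+1)(d+2))`, and the extra `d` gives the last sum.
Since `f 0 = 0`, the identity never contributes. -/
theorem sum_diagProb_mul {n : ℕ} (f : (Fin n → Fin 4) → ℂ) (hf : f 0 = 0) :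
    ∑ p, ∑ q, diagProb p q * (f p * f q) = (((2 ^ n + 1) * (2 ^ n + 2) : ℂ)⁻¹) *
      ((∑ p, f p) ^ 2 + ∑ p, f p * ∑ q, commSign p q * f q + 2 ^ n * ∑ p, f p ^ 2) := by
  have h3 := two_pow_add_ne_zero n 1
  have h4 := two_pow_add_ne_zero n 2
  push_cast at h3 h4
  have h1 : ∀ p q : Fin n → Fin 4, diagProb p q * (f p * f q) =
      (((2 ^ n + 1) * (2 ^ n + 2) : ℂ)⁻¹) * (f p * f q + f p * (commSign p q * f q) +
        if p = q then 2 ^ n * (f p * f q) else 0) := by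
    intro p q
    by_cases hp : p = 0
    · simp [hp, hf]
    by_cases hq : q = 0
    · simp [hq, hf]
    by_cases hpq : p = q
    · subst hpq
      rw [diagProb_self, diagProb_zero hp, commSign_self, if_pos rfl]
      push_cast
      field_simp
      ring
    rw [if_neg hpq]
    rcases commSign_eq_or p q with h | h
    · rw [diagProb_of_comm hp hq hpq h, h]
      push_cast
      field_simp
      ring
    · rw [diagProb_of_anticomm h, h]
      push_cast
      ring
  simp only [h1, ← Finset.mul_sum, Finset.sum_add_distrib, Finset.sum_ite_eq, Finset.mem_univ,
    if_true, ← pow_two, ← Finset.sum_mul]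

theorem varStar_clifford {n : ℕ} (O τ : Op n) (hO : O.trace = 0) :
    varStar (cliffordEnsemble n) O τ = (2 ^ n + 1) / (2 ^ n * (2 ^ n + 2)) *
      (∑ p, crossChar τ O p ^ 2 + ∑ p, crossChar τ O p * twistedCrossChar τ O p) -
      (τ * O).trace ^ 2 / (2 ^ n + 2) := by
  have h3 := two_pow_add_ne_zero n 1
  have h4 := two_pow_add_ne_zero n 2
  push_cast at h3 h4
  have h0 : crossChar O τ 0 = 0 := by simp [crossChar, pauli_zero, hO]
  have hcomm : crossChar O τ = crossChar τ O := by
    ext p; rw [crossChar, crossChar, mul_comm]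
  rw [varStar, (isUnit_measurementChannel_clifford n).2 O hO, trace_crossMoment_mul]
  -- The factor `d + 1` comes from the reconstruction of the traceless `O`, and `1/d` from the Pauli
  -- expansion.
  have h1 : ∀ g : ProjClifford n, (∑ s,
      ((cliffordEnsemble n g : Op n) * ((2 ^ n + 1 : ℂ) • O) *
        (cliffordEnsemble n g : Op n).conjTranspose) s s *
      ((cliffordEnsemble n g : Op n) * τ * (cliffordEnsemble n g : Op n).conjTranspose) s s) ^ 2 =
      ((2 ^ n + 1) / 2 ^ n) ^ 2 * ∑ p, ∑ q, (diagInd (cliffordEnsemble n g : Op n) p *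
        diagInd (cliffordEnsemble n g : Op n) q) * (crossChar O τ p * crossChar O τ q) := by
    intro g
    simp only [Matrix.mul_smul, Matrix.smul_mul, Matrix.smul_apply, smul_eq_mul, mul_assoc,
      ← Finset.mul_sum]
    simp only [← mul_assoc]
    rw [sum_conj_diag_mul (cliffordEnsemble_mem g), mul_pow, mul_pow, ← mul_assoc]
    congr 1
    · field_simp
    · rw [pow_two, Finset.sum_mul_sum]
      refine Finset.sum_congr rfl fun p _ => ?_
      rw [Finset.mul_sum]
      exact Finset.sum_congr rfl fun q _ => by ring
  have h2 : (Fintype.card (ProjClifford n) : ℂ)⁻¹ * ∑ g : ProjClifford n, ∑ p, ∑ q,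
      (diagInd (cliffordEnsemble n g : Op n) p *
        diagInd (cliffordEnsemble n g : Op n) q) * (crossChar O τ p * crossChar O τ q) =
      ∑ p, ∑ q, diagProb p q * (crossChar O τ p * crossChar O τ q) := by
    rw [Finset.sum_comm]
    simp_rw [Finset.sum_comm (s := (Finset.univ : Finset (ProjClifford n))), ← Finset.sum_mul,
      Finset.mul_sum, ← mul_assoc]
    rfl
  simp only [h1, ← Finset.mul_sum]
  -- The square of the total sum contributes `(d+1)/(d+2) · [Tr(τO)]²`; subtracting `[Tr(τO)]²`
  -- leaves the `-1/(d+2)` term.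
  rw [mul_left_comm, h2, sum_diagProb_mul _ h0, hcomm]
  simp only [sum_commSign_crossChar, sum_crossChar]
  rw [Matrix.trace_mul_comm O τ]
  have h5 : ∑ p, crossChar τ O p * (2 ^ n * twistedCrossChar τ O p) =
      2 ^ n * ∑ p, crossChar τ O p * twistedCrossChar τ O p := by
    rw [Finset.mul_sum]
    exact Finset.sum_congr rfl fun p _ => by ring
  rw [h5]
  field_simp
  ring

/-! ### Hilbert–Schmidt and Schatten norms -/

/-- The squared Hilbert–Schmidt norm. -/
def hsSq {n : ℕ} (A : Op n) : ℝ := ∑ i, ∑ j, ‖A i j‖ ^ 2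

theorem hsSq_nonneg {n : ℕ} (A : Op n) : 0 ≤ hsSq A :=
  Finset.sum_nonneg fun _ _ => Finset.sum_nonneg fun _ _ => by positivity

theorem trace_mul_conjTranspose_self {n : ℕ} (A : Op n) :
    (A * A.conjTranspose).trace = (hsSq A : ℂ) := by
  simp only [Matrix.trace, Matrix.diag_apply, Matrix.mul_apply, Matrix.conjTranspose_apply, hsSq,
    Complex.ofReal_sum]
  refine Finset.sum_congr rfl fun i _ => Finset.sum_congr rfl fun j _ => ?_
  rw [Complex.star_def, Complex.mul_conj, Complex.normSq_eq_norm_sq]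

theorem hsSq_conjTranspose {n : ℕ} (A : Op n) : hsSq A.conjTranspose = hsSq A := by
  simp only [hsSq, Matrix.conjTranspose_apply, norm_star]
  exact Finset.sum_comm

theorem trace_conjTranspose_mul_self' {n : ℕ} (A : Op n) :
    (A.conjTranspose * A).trace = (hsSq A : ℂ) := by
  rw [Matrix.trace_mul_comm, trace_mul_conjTranspose_self]

theorem hsSq_unitary_mul {n : ℕ} (U : Matrix.unitaryGroup (Bits n) ℂ) (A : Op n) :
    hsSq ((U : Op n) * A) = hsSq A := by
  have h := trace_conjTranspose_mul_self' ((U : Op n) * A)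
  rw [Matrix.conjTranspose_mul, Matrix.mul_assoc, ← Matrix.mul_assoc _ (U : Op n),
    unitary_conjTranspose_mul, Matrix.one_mul, trace_conjTranspose_mul_self'] at h
  exact_mod_cast h.symm

theorem hsSq_mul_unitary {n : ℕ} (U : Matrix.unitaryGroup (Bits n) ℂ) (A : Op n) :
    hsSq (A * (U : Op n)) = hsSq A := by
  have h := trace_mul_conjTranspose_self (A * (U : Op n))
  rw [Matrix.conjTranspose_mul, Matrix.mul_assoc, ← Matrix.mul_assoc (U : Op n),
    unitary_mul_conjTranspose, Matrix.one_mul, trace_mul_conjTranspose_self] at h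
  exact_mod_cast h.symm

theorem norm_trace_mul_sq_le {n : ℕ} (A B : Op n) :
    ‖(A * B).trace‖ ^ 2 ≤ hsSq A * hsSq B := by
  have h1 : ‖(A * B).trace‖ ≤ ∑ x : Bits n × Bits n, ‖A x.1 x.2‖ * ‖B x.2 x.1‖ := by
    simp only [Matrix.trace, Matrix.diag_apply, Matrix.mul_apply, Fintype.sum_prod_type]
    refine (norm_sum_le _ _).trans (Finset.sum_le_sum fun i _ => ?_)
    refine (norm_sum_le _ _).trans (Finset.sum_le_sum fun j _ => ?_)
    rw [norm_mul]
  have h2 := Finset.sum_mul_sq_le_sq_mul_sq Finset.univ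
    (fun x : Bits n × Bits n => ‖A x.1 x.2‖) (fun x => ‖B x.2 x.1‖)
  refine (pow_le_pow_left₀ (norm_nonneg _) h1 2).trans (h2.trans_eq ?_)
  simp only [Fintype.sum_prod_type, hsSq]
  congr 1
  exact Finset.sum_comm

theorem hsSq_mul_le {n : ℕ} (A B : Op n) : hsSq (A * B) ≤ hsSq A * hsSq B := by
  have key : ∀ i j, ‖(A * B) i j‖ ^ 2 ≤ (∑ k, ‖A i k‖ ^ 2) * ∑ k, ‖B k j‖ ^ 2 := by
    intro i j
    refine (pow_le_pow_left₀ (norm_nonneg _) ?_ 2).trans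
      (Finset.sum_mul_sq_le_sq_mul_sq Finset.univ (fun k => ‖A i k‖) (fun k => ‖B k j‖))
    rw [Matrix.mul_apply]
    refine (norm_sum_le _ _).trans (Finset.sum_le_sum fun k _ => ?_)
    rw [norm_mul]
  have hB : hsSq B = ∑ j, ∑ k, ‖B k j‖ ^ 2 := Finset.sum_comm
  rw [hB, hsSq, hsSq, Finset.sum_mul_sum]
  exact Finset.sum_le_sum fun i _ => Finset.sum_le_sum fun j _ => key i j

theorem schattenNorm_two_sq {n : ℕ} (A : Op n) : schattenNorm 2 A ^ 2 = hsSq A := by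
  have hA := Matrix.isHermitian_conjTranspose_mul_self A
  have hnn := (Matrix.posSemidef_conjTranspose_mul_self A).eigenvalues_nonneg
  have h1 : (∑ i, Real.sqrt (hA.eigenvalues i) ^ (2 : ℝ)) = hsSq A := by
    have h2 := hA.trace_eq_sum_eigenvalues
    rw [trace_conjTranspose_mul_self'] at h2
    have h3 : hsSq A = ∑ i, hA.eigenvalues i :=
      Complex.ofReal_injective (by rw [h2, Complex.ofReal_sum]; rfl)
    rw [h3]
    refine Finset.sum_congr rfl fun i _ => ?_
    rw [Real.rpow_two, Real.sq_sqrt (hnn i)]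
  rw [schattenNorm, h1, ← Real.sqrt_eq_rpow, Real.sq_sqrt (hsSq_nonneg A)]

theorem schattenNorm_one {n : ℕ} (A : Op n) : schattenNorm 1 A =
    ∑ i, Real.sqrt ((Matrix.isHermitian_conjTranspose_mul_self A).eigenvalues i) := by
  simp [schattenNorm]

theorem schattenNorm_one_nonneg {n : ℕ} (A : Op n) : 0 ≤ schattenNorm 1 A := by
  rw [schattenNorm_one]
  exact Finset.sum_nonneg fun _ _ => Real.sqrt_nonneg _

/-- A singular value decomposition. -/
theorem exists_svd {n : ℕ} (A : Op n) : ∃ U V : Matrix.unitaryGroup (Bits n) ℂ,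
    A = (U : Op n) * Matrix.diagonal (fun i => ((Real.sqrt
      ((Matrix.isHermitian_conjTranspose_mul_self A).eigenvalues i) : ℝ) : ℂ)) *
      (V : Op n).conjTranspose := by
  set hA := Matrix.isHermitian_conjTranspose_mul_self A with hhA
  have hnn := (Matrix.posSemidef_conjTranspose_mul_self A).eigenvalues_nonneg
  set V := hA.eigenvectorUnitary
  set lam := hA.eigenvalues
  have hB : (A * (V : Op n)).conjTranspose * (A * (V : Op n)) =
      Matrix.diagonal (fun i => (lam i : ℂ)) := by
    have h := hA.spectral_theorem
    rw [Unitary.conjStarAlgAut_apply] at h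
    rw [Matrix.conjTranspose_mul, Matrix.mul_assoc, ← Matrix.mul_assoc A.conjTranspose, h]
    change (V : Op n).conjTranspose * ((V : Op n) * Matrix.diagonal _ *
      (V : Op n).conjTranspose * (V : Op n)) = _
    rw [Matrix.mul_assoc, unitary_conjTranspose_mul, Matrix.mul_one, ← Matrix.mul_assoc,
      unitary_conjTranspose_mul, Matrix.one_mul]
    rfl
  set B := A * (V : Op n) with hBdef
  have hBin : ∀ i j, ∑ k, star (B k i) * B k j = if i = j then (lam i : ℂ) else 0 := by
    intro i j
    have := congrFun (congrFun hB i) j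
    simpa only [Matrix.mul_apply, Matrix.conjTranspose_apply, Matrix.diagonal_apply] using this
  -- The columns of `A V` are orthogonal with squared norms `lam j`. Normalizing the nonzero ones
  -- gives an orthonormal family, later completed to the columns of `U`.
  let w : Bits n → EuclideanSpace ℂ (Bits n) := fun j =>
    WithLp.toLp 2 fun i => ((Real.sqrt (lam j))⁻¹ : ℂ) * B i j
  let s : Set (Bits n) := {j | lam j ≠ 0}
  have hw : Orthonormal ℂ (s.domRestrict w) := by
    rw [orthonormal_iff_ite]
    rintro ⟨i, hi⟩ ⟨j, hj⟩
    have e : inner ℂ (w i) (w j) = ((Real.sqrt (lam i))⁻¹ : ℂ) * ((Real.sqrt (lam j))⁻¹ : ℂ) *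
        ∑ k, star (B k i) * B k j := by
      simp only [w, PiLp.inner_apply, RCLike.inner_apply, map_mul, map_inv₀, Finset.mul_sum,
        Complex.conj_ofReal]
      refine Finset.sum_congr rfl fun k _ => ?_
      rw [Complex.star_def]
      ring
    change inner ℂ (w i) (w j) = _
    rw [e, hBin]
    simp only [Subtype.mk.injEq]
    split_ifs with hij
    · subst hij
      have h0 : (Real.sqrt (lam i)) ≠ 0 :=
        (Real.sqrt_pos.2 (lt_of_le_of_ne (hnn i) (Ne.symm hi))).ne'
      have h1 : (lam i : ℂ) = (Real.sqrt (lam i) : ℂ) * (Real.sqrt (lam i) : ℂ) := by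
        rw [← Complex.ofReal_mul, Real.mul_self_sqrt (hnn i)]
      have h2 : (Real.sqrt (lam i) : ℂ) ≠ 0 := by exact_mod_cast h0
      rw [h1]
      field_simp
    · simp
  obtain ⟨b, hb⟩ := hw.exists_orthonormalBasis_extension_of_card_eq (by simp)
  let U : Op n := Matrix.of fun i j => b j i
  have hU : U ∈ Matrix.unitaryGroup (Bits n) ℂ := by
    rw [Matrix.mem_unitaryGroup_iff']
    ext i j
    have := orthonormal_iff_ite.1 b.orthonormal i j
    rw [PiLp.inner_apply] at this
    rw [Matrix.one_apply, ← this, Matrix.mul_apply]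
    refine Finset.sum_congr rfl fun k _ => ?_
    simp [U, Matrix.star_apply, mul_comm]
  have hfac : B = U * Matrix.diagonal (fun i => ((Real.sqrt (lam i) : ℝ) : ℂ)) := by
    ext i j
    rw [Matrix.mul_diagonal]
    -- Where the singular value is zero the column of `B` vanishes, so the basis vector chosen there
    -- is immaterial.
    by_cases hj : lam j = 0
    · have h1 := hBin j j
      rw [if_pos rfl, hj] at h1
      have h2 : ∑ k, ‖B k j‖ ^ 2 = 0 := by
        have : ((∑ k, ‖B k j‖ ^ 2 : ℝ) : ℂ) = 0 := by
          rw [Complex.ofReal_zero] at h1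
          rw [← h1, Complex.ofReal_sum]
          refine Finset.sum_congr rfl fun k _ => ?_
          rw [mul_comm, Complex.star_def, Complex.mul_conj, Complex.normSq_eq_norm_sq]
        exact_mod_cast this
      have h3 := (Finset.sum_eq_zero_iff_of_nonneg (fun k _ => by positivity)).1 h2 i
        (Finset.mem_univ _)
      have h4 : B i j = 0 := by simpa using h3
      simp [h4, hj]
    · have h0 : (Real.sqrt (lam j)) ≠ 0 :=
        (Real.sqrt_pos.2 (lt_of_le_of_ne (hnn j) (Ne.symm hj))).ne'
      have h2 : (Real.sqrt (lam j) : ℂ) ≠ 0 := by exact_mod_cast h0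
      have h5 : U i j = ((Real.sqrt (lam j))⁻¹ : ℂ) * B i j := by
        simp only [U, Matrix.of_apply, hb j hj, w]
      rw [h5]
      field_simp
  refine ⟨⟨U, hU⟩, V, ?_⟩
  change A = U * Matrix.diagonal (fun i => ((Real.sqrt (lam i) : ℝ) : ℂ)) * (V : Op n).conjTranspose
  rw [← hfac, hBdef, Matrix.mul_assoc, unitary_mul_conjTranspose, Matrix.mul_one]

/-- By the singular value decomposition the trace is a combination of the singular values with
diagonal entries of a unitary as weights, each of modulus at most one. -/
theorem norm_trace_unitary_mul_le {n : ℕ} (W : Matrix.unitaryGroup (Bits n) ℂ) (A : Op n) :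
    ‖((W : Op n) * A).trace‖ ≤ schattenNorm 1 A := by
  obtain ⟨U, V, h⟩ := exists_svd A
  set D := Matrix.diagonal (fun i => ((Real.sqrt
      ((Matrix.isHermitian_conjTranspose_mul_self A).eigenvalues i) : ℝ) : ℂ)) with hD
  have h1 : ((W : Op n) * A).trace = (((V⁻¹ * W * U : Matrix.unitaryGroup (Bits n) ℂ) : Op n) *
      D).trace := by
    have e : ((V⁻¹ * W * U : Matrix.unitaryGroup (Bits n) ℂ) : Op n) =
      (V : Op n).conjTranspose * (W : Op n) * (U : Op n) := rfl
    rw [e, h, ← Matrix.mul_assoc, Matrix.trace_mul_comm]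
    simp only [Matrix.mul_assoc]
  rw [h1, schattenNorm_one]
  simp only [Matrix.trace, Matrix.diag_apply, hD, Matrix.mul_diagonal]
  refine (norm_sum_le _ _).trans (Finset.sum_le_sum fun i _ => ?_)
  rw [norm_mul, Complex.norm_real, Real.norm_of_nonneg (Real.sqrt_nonneg _)]
  exact mul_le_of_le_one_left (Real.sqrt_nonneg _)
    (entry_norm_bound_of_unitary (V⁻¹ * W * U : Matrix.unitaryGroup (Bits n) ℂ).2 i i)

theorem exists_trace_unitary_mul_eq {n : ℕ} (A : Op n) :
    ∃ W : Matrix.unitaryGroup (Bits n) ℂ, ((W : Op n) * A).trace = (schattenNorm 1 A : ℂ) := by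
  obtain ⟨U, V, h⟩ := exists_svd A
  refine ⟨V * U⁻¹, ?_⟩
  have e : ((V * U⁻¹ : Matrix.unitaryGroup (Bits n) ℂ) : Op n) =
      (V : Op n) * (U : Op n).conjTranspose := rfl
  have h2 : ((schattenNorm 1 A : ℝ) : ℂ) = (Matrix.diagonal (fun i => ((Real.sqrt
      ((Matrix.isHermitian_conjTranspose_mul_self A).eigenvalues i) : ℝ) : ℂ))).trace := by
    rw [schattenNorm_one, Matrix.trace_diagonal, Complex.ofReal_sum]
  rw [e, h2]
  generalize Matrix.diagonal (fun i => ((Real.sqrt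
      ((Matrix.isHermitian_conjTranspose_mul_self A).eigenvalues i) : ℝ) : ℂ)) = D at h
  rw [h, Matrix.mul_assoc, Matrix.mul_assoc, ← Matrix.mul_assoc (U : Op n).conjTranspose,
    unitary_conjTranspose_mul, Matrix.one_mul, Matrix.trace_mul_comm, Matrix.mul_assoc,
    unitary_conjTranspose_mul, Matrix.mul_one]

/-! ### Trace distance and infidelity -/

theorem sqrt_isHermitian {n : ℕ} (ρ : Op n) : (CFC.sqrt ρ).conjTranspose = CFC.sqrt ρ :=
  (Matrix.nonneg_iff_posSemidef.1 (CFC.sqrt_nonneg ρ)).isHermitian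

theorem sqrt_mul_sqrt {n : ℕ} {ρ : Op n} (hρ : ρ.PosSemidef) : CFC.sqrt ρ * CFC.sqrt ρ = ρ :=
  CFC.sqrt_mul_sqrt_self ρ (Matrix.nonneg_iff_posSemidef.2 hρ)

theorem hsSq_add_of_trace {n : ℕ} {A C : Op n} {f : ℝ} (hA : (A * A.conjTranspose).trace = 1)
    (hC : (C * C.conjTranspose).trace = 1) (hAC : (C * A.conjTranspose).trace = f) :
    hsSq (A + C) = 2 + 2 * f ∧ hsSq (A - C) = 2 - 2 * f := by
  have hCA : (A * C.conjTranspose).trace = f := by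
    have h := Matrix.trace_conjTranspose (C * A.conjTranspose)
    rw [Matrix.conjTranspose_mul, Matrix.conjTranspose_conjTranspose, hAC] at h
    simpa using h
  constructor
  · have h := trace_mul_conjTranspose_self (A + C)
    simp only [Matrix.conjTranspose_add, Matrix.add_mul, Matrix.mul_add, Matrix.trace_add, hA, hC,
      hAC, hCA] at h
    have h' : ((2 + 2 * f : ℝ) : ℂ) = hsSq (A + C) := by
      rw [← h]; push_cast; ring
    exact (Complex.ofReal_injective h').symm
  · have h := trace_mul_conjTranspose_self (A - C)
    simp only [Matrix.conjTranspose_sub, Matrix.sub_mul, Matrix.mul_sub, Matrix.trace_sub, hA, hC,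
      hAC, hCA] at h
    have h' : ((2 - 2 * f : ℝ) : ℂ) = hsSq (A - C) := by
      rw [← h]; push_cast; ring
    exact (Complex.ofReal_injective h').symm

/-- The Fuchs–van de Graaf inequality between the trace distance and the infidelity. -/
theorem schattenNorm_one_sub_sq_le {n : ℕ} {ρ σ : Op n} (hρ : IsDensity ρ) (hσ : IsDensity σ) :
    schattenNorm 1 (ρ - σ) ^ 2 ≤ 4 * infidelity ρ σ := by
  set A := CFC.sqrt ρ with hA
  set B := CFC.sqrt σ with hB
  have hAh : A.conjTranspose = A := sqrt_isHermitian ρ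
  have hBh : B.conjTranspose = B := sqrt_isHermitian σ
  have hAA : A * A = ρ := sqrt_mul_sqrt hρ.1
  have hBB : B * B = σ := sqrt_mul_sqrt hσ.1
  obtain ⟨W, hW⟩ := exists_trace_unitary_mul_eq (A * B)
  obtain ⟨S, hS⟩ := exists_trace_unitary_mul_eq (ρ - σ)
  set f := schattenNorm 1 (A * B) with hf
  -- As in Uhlmann's theorem, the freedom in factoring `σ = C C†` is used to make `Tr(C A†)` equal
  -- to the root fidelity `f`.
  set C := B * (W : Op n) with hC
  have hCC : C * C.conjTranspose = σ := by
    rw [hC, Matrix.conjTranspose_mul, Matrix.mul_assoc, ← Matrix.mul_assoc (W : Op n),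
      unitary_mul_conjTranspose, Matrix.one_mul, hBh, hBB]
  have hAA' : A * A.conjTranspose = ρ := by rw [hAh, hAA]
  obtain ⟨h1, h2⟩ := hsSq_add_of_trace (A := A) (C := C) (f := f) (by rw [hAA', hρ.2])
    (by rw [hCC, hσ.2]) (by
      rw [hAh, hC, Matrix.mul_assoc, Matrix.trace_mul_comm, Matrix.mul_assoc, hW])
  -- Polarization of `A A† - C C†`; the factors have squared norms `2 - 2f` and `2 + 2f`.
  have hdec : ρ - σ = (1 / 2 : ℂ) • ((A - C) * (A + C).conjTranspose +
      (A + C) * (A - C).conjTranspose) := by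
    simp only [Matrix.conjTranspose_sub, Matrix.conjTranspose_add, Matrix.sub_mul, Matrix.mul_sub,
      Matrix.mul_add, Matrix.add_mul, hAA', hCC]
    module
  have hcs : ∀ X Y : Op n, ‖((S : Op n) * (X * Y.conjTranspose)).trace‖ ^ 2 ≤ hsSq X * hsSq Y := by
    intro X Y
    have := norm_trace_mul_sq_le ((S : Op n) * X) Y.conjTranspose
    rwa [hsSq_unitary_mul, hsSq_conjTranspose, Matrix.mul_assoc] at this
  have h3 := hcs (A - C) (A + C)
  have h4 := hcs (A + C) (A - C)
  rw [h1, h2] at h3 h4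
  have h5 : schattenNorm 1 (ρ - σ) ≤ 1 / 2 *
      (‖((S : Op n) * ((A - C) * (A + C).conjTranspose)).trace‖ +
        ‖((S : Op n) * ((A + C) * (A - C).conjTranspose)).trace‖) := by
    have e : schattenNorm 1 (ρ - σ) = ‖((S : Op n) * (ρ - σ)).trace‖ := by
      rw [hS, Complex.norm_real, Real.norm_of_nonneg (schattenNorm_one_nonneg _)]
    rw [e, hdec, Matrix.mul_smul, Matrix.trace_smul, Matrix.mul_add, Matrix.trace_add, norm_smul]
    have : ‖(1 / 2 : ℂ)‖ = 1 / 2 := by norm_num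
    rw [this]
    gcongr
    exact norm_add_le _ _
  have h6 := schattenNorm_one_nonneg (ρ - σ)
  have h7 := pow_le_pow_left₀ h6 h5 2
  have h8 : infidelity ρ σ = 1 - f ^ 2 := rfl
  rw [h8]
  -- Both traces have square at most `(2 - 2f)(2 + 2f) = 4(1 - f²)`, hence so does the square of
  -- their mean.
  nlinarith [sq_nonneg (‖((S : Op n) * ((A - C) * (A + C).conjTranspose)).trace‖ -
        ‖((S : Op n) * ((A + C) * (A - C).conjTranspose)).trace‖)]

/-! ### Sharper estimates for a pure state -/

theorem IsPure.mul_mul {n : ℕ} {σ : Op n} (hσ : IsPure σ) (M : Op n) :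
    σ * M * σ = (σ * M).trace • σ := by
  obtain ⟨φ, -, rfl⟩ := hσ
  rw [Matrix.vecMulVec_mul, Matrix.vecMulVec_mul_vecMulVec, Matrix.trace_vecMulVec,
    dotProduct_comm, Matrix.vecMulVec_smul]

theorem IsPure.trace {n : ℕ} {σ : Op n} (hσ : IsPure σ) : σ.trace = 1 := by
  obtain ⟨φ, h, rfl⟩ := hσ
  rw [Matrix.trace_vecMulVec, dotProduct_comm, h]

theorem IsPure.mul_self {n : ℕ} {σ : Op n} (hσ : IsPure σ) : σ * σ = σ := by
  have := hσ.mul_mul 1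
  rwa [Matrix.mul_one, hσ.trace, one_smul] at this

theorem IsPure.conjTranspose {n : ℕ} {σ : Op n} (hσ : IsPure σ) : σ.conjTranspose = σ := by
  obtain ⟨φ, h, rfl⟩ := hσ
  rw [Matrix.conjTranspose_vecMulVec, star_star]

theorem trace_mul_hermitian {n : ℕ} {A B : Op n} (hA : A.IsHermitian) (hB : B.IsHermitian) :
    (A * B).trace = ((A * B).trace.re : ℂ) := by
  have h := Matrix.trace_conjTranspose (A * B)
  rw [Matrix.conjTranspose_mul, hA.eq, hB.eq, Matrix.trace_mul_comm] at h
  exact (Complex.conj_eq_iff_re.1 h.symm).symm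

theorem hsSq_of_isHermitian {n : ℕ} {A : Op n} (hA : A.IsHermitian) :
    (A * A).trace = (hsSq A : ℂ) := by
  rw [← trace_mul_conjTranspose_self, hA.eq]

/-- Here `√σ = σ`. Inserting a second `σ` next to the optimal unitary, Cauchy–Schwarz gives `‖√ρ
σ‖₁² ≤ ‖σ W‖₂² ‖√ρ σ‖₂² = Tr(ρσ)`. -/
theorem trace_le_infidelity_of_isPure {n : ℕ} {ρ σ : Op n} (hρ : IsDensity ρ) (hσ : IsDensity σ)
    (hp : IsPure σ) : 1 - (ρ * σ).trace.re ≤ infidelity ρ σ := by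
  have hs : CFC.sqrt σ = σ := CFC.sqrt_unique hp.mul_self (Matrix.nonneg_iff_posSemidef.2 hσ.1)
  rw [infidelity, hs]
  obtain ⟨W, hW⟩ := exists_trace_unitary_mul_eq (CFC.sqrt ρ * σ)
  have h1 := norm_trace_mul_sq_le (σ * (W : Op n)) (CFC.sqrt ρ * σ)
  have h2 : (σ * (W : Op n) * (CFC.sqrt ρ * σ)).trace = schattenNorm 1 (CFC.sqrt ρ * σ) := by
    rw [← hW, Matrix.mul_assoc, Matrix.trace_mul_comm, Matrix.mul_assoc, Matrix.mul_assoc,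
      hp.mul_self]
  have h3 : hsSq σ = 1 := by
    have := hsSq_of_isHermitian hσ.1.isHermitian
    rw [hp.mul_self, hσ.2] at this
    exact_mod_cast this.symm
  have h4 : hsSq (CFC.sqrt ρ * σ) = (ρ * σ).trace.re := by
    have := trace_mul_conjTranspose_self (CFC.sqrt ρ * σ)
    rw [Matrix.conjTranspose_mul, hp.conjTranspose, sqrt_isHermitian, Matrix.mul_assoc,
      ← Matrix.mul_assoc σ, hp.mul_self, Matrix.trace_mul_comm, Matrix.mul_assoc,
      sqrt_mul_sqrt hρ.1, Matrix.trace_mul_comm] at this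
    rw [this, Complex.ofReal_re]
  rw [h2, hsSq_mul_unitary, h3, h4, one_mul, Complex.norm_real, Real.norm_eq_abs, sq_abs] at h1
  linarith

theorem hsSq_sqrt {n : ℕ} {ρ : Op n} (hρ : IsDensity ρ) : hsSq (CFC.sqrt ρ) = 1 := by
  have := trace_mul_conjTranspose_self (CFC.sqrt ρ)
  rw [sqrt_isHermitian, sqrt_mul_sqrt hρ.1, hρ.2] at this
  exact_mod_cast this.symm

/-- Since `Tr ρ² ≤ 1`, the expansion `Tr ρ² - 2 Tr(ρσ) + 1` is at most `2(1 - Tr(ρσ))`. -/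
theorem hsSq_sub_le_infidelity_of_isPure {n : ℕ} {ρ σ : Op n} (hρ : IsDensity ρ)
    (hσ : IsDensity σ) (hp : IsPure σ) : hsSq (ρ - σ) ≤ 2 * infidelity ρ σ := by
  have h1 := trace_le_infidelity_of_isPure hρ hσ hp
  have h2 : hsSq ρ ≤ 1 := by
    have := hsSq_mul_le (CFC.sqrt ρ) (CFC.sqrt ρ)
    rwa [sqrt_mul_sqrt hρ.1, hsSq_sqrt hρ, one_mul] at this
  have h3 := hsSq_of_isHermitian (hρ.1.isHermitian.sub hσ.1.isHermitian)
  rw [Matrix.sub_mul, Matrix.mul_sub, Matrix.mul_sub, hp.mul_self, Matrix.trace_sub,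
    Matrix.trace_sub, Matrix.trace_sub, hσ.2, Matrix.trace_mul_comm σ ρ,
    hsSq_of_isHermitian hρ.1.isHermitian, trace_mul_hermitian hρ.1.isHermitian hσ.1.isHermitian]
    at h3
  have h4 : hsSq ρ - (ρ * σ).trace.re - ((ρ * σ).trace.re - 1) = hsSq (ρ - σ) := by
    exact_mod_cast h3
  linarith

/-- The negative part of `ρ - σ` has rank one when `σ` is pure. -/
theorem neg_trace_projection_le_of_isPure {n : ℕ} {ρ σ Q : Op n} (hρ : IsDensity ρ)
    (hσ : IsDensity σ) (hp : IsPure σ) (hQ : Q.IsHermitian) (hQQ : Q * Q = Q) :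
    -((ρ - σ) * Q).trace.re ≤ Real.sqrt (hsSq (ρ - σ)) := by
  have hρh := hρ.1.isHermitian
  have hσh := hσ.1.isHermitian
  set R := CFC.sqrt ρ
  have hR : R.conjTranspose = R := sqrt_isHermitian ρ
  have hRR : R * R = ρ := sqrt_mul_sqrt hρ.1
  have ht := trace_mul_hermitian hσh hQ
  set t := (σ * Q).trace.re with htdef
  have hr : hsSq (R * Q) = (ρ * Q).trace.re := by
    have := trace_conjTranspose_mul_self' (R * Q)
    rw [Matrix.conjTranspose_mul, hQ.eq, hR, Matrix.mul_assoc, ← Matrix.mul_assoc R, hRR,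
      Matrix.trace_mul_comm, Matrix.mul_assoc, hQQ] at this
    rw [this, Complex.ofReal_re]
  have hQσ : hsSq (Q * σ) = t := by
    have := trace_mul_conjTranspose_self (Q * σ)
    rw [Matrix.conjTranspose_mul, hQ.eq, hσh.eq, Matrix.mul_assoc, ← Matrix.mul_assoc σ,
      hp.mul_self, Matrix.trace_mul_comm, Matrix.mul_assoc, hQQ, ht] at this
    exact_mod_cast this.symm
  have hσQσ : σ * Q * σ = (t : ℂ) • σ := by rw [hp.mul_mul, ht]
  -- No spectral decomposition is needed: `ρ - σ` is tested against `Q σ Q`, which has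
  -- Hilbert–Schmidt norm `t = Tr(σQ)`.
  have hX1 : ((ρ - σ) * (Q * σ * Q)).trace = ((hsSq (R * Q * (Q * σ)) - t ^ 2 : ℝ) : ℂ) := by
    have e1 : (ρ * (Q * σ * Q)).trace = hsSq (R * Q * (Q * σ)) := by
      rw [← trace_mul_conjTranspose_self]
      have : R * Q * (Q * σ) = R * (Q * σ) := by
        rw [Matrix.mul_assoc, ← Matrix.mul_assoc Q Q, hQQ]
      rw [this, Matrix.conjTranspose_mul, Matrix.conjTranspose_mul, hR, hQ.eq, hσh.eq]
      calc (ρ * (Q * σ * Q)).trace = (R * (R * (Q * (σ * σ) * Q))).trace := by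
            rw [hp.mul_self, ← Matrix.mul_assoc R R, hRR]
        _ = (R * (Q * (σ * σ) * Q) * R).trace := Matrix.trace_mul_comm _ _
        _ = _ := by simp only [Matrix.mul_assoc]
    have e2 : (σ * (Q * σ * Q)).trace = ((t ^ 2 : ℝ) : ℂ) := by
      rw [← Matrix.mul_assoc, ← Matrix.mul_assoc, hσQσ, Matrix.smul_mul, Matrix.trace_smul, ht,
        smul_eq_mul]
      push_cast
      ring
    rw [Matrix.sub_mul, Matrix.trace_sub, e1, e2, Complex.ofReal_sub]
  have hX2 : hsSq (Q * σ * Q) = t ^ 2 := by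
    have := trace_mul_conjTranspose_self (Q * σ * Q)
    rw [Matrix.conjTranspose_mul, Matrix.conjTranspose_mul, hQ.eq, hσh.eq] at this
    have e : Q * σ * Q * (Q * (σ * Q)) = (t : ℂ) • (Q * (σ * Q)) := by
      calc Q * σ * Q * (Q * (σ * Q)) = Q * (σ * (Q * Q) * σ) * Q := by
            simp only [Matrix.mul_assoc]
        _ = _ := by rw [hQQ, hσQσ, Matrix.mul_smul, Matrix.smul_mul, Matrix.mul_assoc]
    rw [e, Matrix.trace_smul, Matrix.trace_mul_comm, Matrix.mul_assoc, hQQ, ht, smul_eq_mul] at this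
    have h' : t * t = hsSq (Q * σ * Q) := by exact_mod_cast this
    rw [← h', pow_two]
  -- With `r = Tr(ρQ)` this bounds the `ρ` term by `r t`. Cauchy–Schwarz then gives `t² - r t ≤ ‖ρ -
  -- σ‖₂ t`, and dividing by `t` yields the claim.
  have hle := hsSq_mul_le (R * Q) (Q * σ)
  rw [hr, hQσ] at hle
  have ht0 : 0 ≤ t := hQσ ▸ hsSq_nonneg _
  have hr0 : 0 ≤ (ρ * Q).trace.re := hr ▸ hsSq_nonneg _
  have hcs := norm_trace_mul_sq_le (ρ - σ) (Q * σ * Q)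
  rw [hX1, hX2, Complex.norm_real, Real.norm_eq_abs, sq_abs] at hcs
  have hsq := Real.sq_sqrt (hsSq_nonneg (ρ - σ))
  have hsn := Real.sqrt_nonneg (hsSq (ρ - σ))
  have h1 : t ^ 2 - hsSq (R * Q * (Q * σ)) ≤ Real.sqrt (hsSq (ρ - σ)) * t := by
    refine le_of_sq_le_sq ?_ (by positivity)
    rw [mul_pow, hsq]
    linarith [hcs]
  rw [Matrix.sub_mul, Matrix.trace_sub, Complex.sub_re]
  -- If `t = 0` no division is possible, but then the left side is `-r ≤ 0`.
  rcases ht0.eq_or_lt with h0 | h0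
  · rw [← htdef, ← h0]
    linarith
  · rw [← htdef]
    refine le_of_mul_le_mul_right ?_ h0
    nlinarith

/-- Apply the projection bound to `Q = (1 ± P)/2`: as `ρ - σ` is traceless, `Tr((ρ - σ)Q)` is `±
Ξ(P)/2`. The two signs bound the absolute value. -/
theorem charFn_sub_sq_le_of_isPure {n : ℕ} {ρ σ : Op n} (hρ : IsDensity ρ)
    (hσ : IsDensity σ) (hp : IsPure σ) (p : Fin n → Fin 4) :
    (charFn (ρ - σ) p).re ^ 2 ≤ 4 * hsSq (ρ - σ) := by
  have hP : (pauli p).IsHermitian := pauli_conjTranspose p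
  have htr : (ρ - σ).trace = 0 := by rw [Matrix.trace_sub, hρ.2, hσ.2, sub_self]
  have key : ∀ c : ℂ, c ^ 2 = 1 → star c = c →
      -(c * charFn (ρ - σ) p).re ≤ 2 * Real.sqrt (hsSq (ρ - σ)) := by
    intro c hc hc'
    have h := neg_trace_projection_le_of_isPure hρ hσ hp (Q := (1 / 2 : ℂ) • (1 + c • pauli p))
      (by
        simp only [Matrix.IsHermitian, Matrix.conjTranspose_smul, Matrix.conjTranspose_add,
          Matrix.conjTranspose_one, hP.eq, hc']
        norm_num)
      (by
        simp only [Matrix.smul_mul, Matrix.mul_smul, Matrix.add_mul, Matrix.mul_add,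
          Matrix.one_mul, Matrix.mul_one, pauli_sq]
        match_scalars
        · linear_combination (1 / 4 : ℂ) * hc
        · ring)
    rw [Matrix.mul_smul, Matrix.mul_add, Matrix.mul_one, Matrix.mul_smul, Matrix.trace_smul,
      Matrix.trace_add, htr, zero_add, Matrix.trace_smul, smul_eq_mul, smul_eq_mul] at h
    have e : ((1 / 2 : ℂ) * (c * ((ρ - σ) * pauli p).trace)).re =
        1 / 2 * (c * charFn (ρ - σ) p).re := by
      rw [charFn, show (1 / 2 : ℂ) = ((1 / 2 : ℝ) : ℂ) by norm_num, Complex.re_ofReal_mul]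
    rw [e] at h
    linarith
  have h1 := key 1 (by norm_num) (by simp)
  have h2 := key (-1) (by norm_num) (by simp)
  rw [one_mul] at h1
  rw [neg_one_mul, Complex.neg_re, neg_neg] at h2
  have h3 : |(charFn (ρ - σ) p).re| ≤ |2 * Real.sqrt (hsSq (ρ - σ))| :=
    (abs_le.2 ⟨by linarith, h2⟩).trans (le_abs_self _)
  have h4 := sq_le_sq.2 h3
  rw [mul_pow, Real.sq_sqrt (hsSq_nonneg _)] at h4
  linarith

/-! ### Real characteristic functions and the variance bounds -/

theorem IsDensity.isHermitian {n : ℕ} {ρ : Op n} (hρ : IsDensity ρ) : ρ.IsHermitian :=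
  hρ.1.isHermitian

theorem charFn_eq_re {n : ℕ} {A : Op n} (hA : A.IsHermitian) (p : Fin n → Fin 4) :
    charFn A p = ((charFn A p).re : ℂ) := trace_mul_hermitian hA (pauli_conjTranspose p)

theorem crossChar_eq_re {n : ℕ} {A B : Op n} (hA : A.IsHermitian) (hB : B.IsHermitian)
    (p : Fin n → Fin 4) :
    crossChar A B p = (((charFn A p).re * (charFn B p).re : ℝ) : ℂ) := by
  rw [Complex.ofReal_mul, ← charFn_eq_re hA, ← charFn_eq_re hB]
  rfl

theorem twistedCrossChar_eq_re {n : ℕ} {A B : Op n} (hA : A.IsHermitian) (hB : B.IsHermitian)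
    (p : Fin n → Fin 4) : twistedCrossChar A B p = ((twistedCrossChar A B p).re : ℂ) := by
  have hP : (pauli p).IsHermitian := pauli_conjTranspose p
  have e : twistedCrossChar A B p = (A * (pauli p * B * pauli p)).trace := by
    simp only [twistedCrossChar, Matrix.mul_assoc]
  rw [e]
  refine trace_mul_hermitian hA ?_
  simp only [Matrix.IsHermitian, Matrix.conjTranspose_mul, hP.eq, hB.eq, Matrix.mul_assoc]

theorem lpNorm_two_sq {n : ℕ} (f : (Fin n → Fin 4) → ℂ) : lpNorm 2 f ^ 2 = ∑ p, ‖f p‖ ^ 2 := by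
  rw [lpNorm, PiLp.norm_sq_eq_of_L2]

theorem lpNorm_four_pow {n : ℕ} (f : (Fin n → Fin 4) → ℂ) : lpNorm 4 f ^ 4 = ∑ p, ‖f p‖ ^ 4 := by
  have h4 : (4 : ℝ≥0∞).toReal = 4 := by norm_num
  rw [lpNorm, PiLp.norm_eq_sum (by rw [h4]; norm_num), h4, ← Real.rpow_natCast, ← Real.rpow_mul]
  · norm_num
  · exact Finset.sum_nonneg fun _ _ => by positivity

theorem lpNorm_two_crossChar_sq {n : ℕ} {A B : Op n} (hA : A.IsHermitian) (hB : B.IsHermitian) :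
    lpNorm 2 (crossChar A B) ^ 2 = ∑ p, ((charFn A p).re * (charFn B p).re) ^ 2 := by
  rw [lpNorm_two_sq]
  refine Finset.sum_congr rfl fun p _ => ?_
  rw [crossChar_eq_re hA hB, Complex.norm_real, Real.norm_eq_abs, sq_abs]

theorem sum_charFn_re_sq {n : ℕ} {A : Op n} (hA : A.IsHermitian) :
    ∑ p, (charFn A p).re ^ 2 = 2 ^ n * hsSq A := by
  have h := sum_crossChar A A
  rw [hsSq_of_isHermitian hA] at h
  simp only [crossChar_eq_re hA hA, ← pow_two] at h
  exact_mod_cast h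

/-- The twisted function is `d⁻¹` times the sign matrix applied to the cross characteristic
function, and by character orthogonality that matrix is `d` times an orthogonal one. -/
theorem sum_twistedCrossChar_sq {n : ℕ} {A B : Op n} (hA : A.IsHermitian) (hB : B.IsHermitian) :
    ∑ p, (twistedCrossChar A B p).re ^ 2 = ∑ p, ((charFn A p).re * (charFn B p).re) ^ 2 := by
  set x : (Fin n → Fin 4) → ℝ := fun p => (charFn A p).re * (charFn B p).re with hx
  have h1 : ∀ p, 2 ^ n * (twistedCrossChar A B p).re = ∑ q, (commSign p q : ℝ) * x q := by
    intro p
    have h := sum_commSign_crossChar A B p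
    rw [twistedCrossChar_eq_re hA hB] at h
    simp only [crossChar_eq_re hA hB] at h
    exact_mod_cast h.symm
  have h2 : ∀ q r : Fin n → Fin 4, ∑ p, (commSign p q : ℝ) * commSign p r =
      if q = r then (2 ^ n) ^ 2 else 0 := by
    intro q r
    have h := sum_commSign_mul q r
    have h' : ∑ p, (commSign p q : ℝ) * commSign p r = if q = r then (4 : ℝ) ^ n else 0 := by
      simp only [commSign_comm _ q, commSign_comm _ r]
      exact_mod_cast h
    rw [h', ← pow_mul, mul_comm n 2, pow_mul]
    norm_num
  have h3 : ∑ p, (2 ^ n * (twistedCrossChar A B p).re) ^ 2 = (2 ^ n) ^ 2 * ∑ q, x q ^ 2 := by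
    simp only [h1, pow_two (∑ q, _), Finset.sum_mul_sum]
    rw [Finset.sum_comm, Finset.mul_sum]
    refine Finset.sum_congr rfl fun q _ => ?_
    rw [Finset.sum_comm]
    have h4 : ∀ r, ∑ p, (commSign p q : ℝ) * x q * (commSign p r * x r) =
        (if q = r then (2 ^ n) ^ 2 else 0) * (x q * x r) := by
      intro r
      rw [← h2, Finset.sum_mul]
      exact Finset.sum_congr rfl fun p _ => by ring
    simp only [h4, ite_mul, zero_mul, Finset.sum_ite_eq, Finset.mem_univ, if_true, ← pow_two]
  simp only [mul_pow, ← Finset.mul_sum] at h3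
  have h4 := mul_left_cancel₀ (by positivity) h3
  simpa only [hx, mul_pow] using h4

theorem varStar_eq_ofReal {n : ℕ} {O τ : Op n} (hO : O.IsHermitian) (hτ : τ.IsHermitian)
    (hO0 : O.trace = 0) : varStar (cliffordEnsemble n) O τ =
      (((2 ^ n + 1) / (2 ^ n * (2 ^ n + 2)) * (∑ p, ((charFn τ p).re * (charFn O p).re) ^ 2 +
        ∑ p, ((charFn τ p).re * (charFn O p).re) * (twistedCrossChar τ O p).re) -
        (τ * O).trace.re ^ 2 / (2 ^ n + 2) : ℝ) : ℂ) := by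
  rw [varStar_clifford O τ hO0, trace_mul_hermitian hτ hO]
  have h : ∑ p, crossChar τ O p * twistedCrossChar τ O p = ((∑ p, ((charFn τ p).re *
      (charFn O p).re) * (twistedCrossChar τ O p).re : ℝ) : ℂ) := by
    rw [Complex.ofReal_sum]
    exact Finset.sum_congr rfl fun p _ => by
      rw [Complex.ofReal_mul, ← crossChar_eq_re hτ hO, ← twistedCrossChar_eq_re hτ hO]
  rw [h]
  simp only [crossChar_eq_re hτ hO, Complex.ofReal_re]
  push_cast
  rfl

/-- As `Ξ` and `Ξ̃` have equal norms, their inner product is at most `‖Ξ‖₂²`. Drop the negative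
trace term and use `(d+1)/(d+2) ≤ 1`. -/
theorem varStar_re_le {n : ℕ} {O τ : Op n} (hO : O.IsHermitian) (hτ : τ.IsHermitian)
    (hO0 : O.trace = 0) : (varStar (cliffordEnsemble n) O τ).re ≤
      2 / dim n * lpNorm 2 (crossChar τ O) ^ 2 := by
  rw [varStar_eq_ofReal hO hτ hO0, Complex.ofReal_re, lpNorm_two_crossChar_sq hτ hO, dim]
  have h1 := sum_twistedCrossChar_sq hτ hO
  set S := ∑ p, ((charFn τ p).re * (charFn O p).re) ^ 2
  have h2 : ∑ p, ((charFn τ p).re * (charFn O p).re) * (twistedCrossChar τ O p).re ≤ S := by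
    have : S = ∑ p, (((charFn τ p).re * (charFn O p).re) ^ 2 +
        (twistedCrossChar τ O p).re ^ 2) / 2 := by
      rw [← Finset.sum_div, Finset.sum_add_distrib, h1]
      ring
    rw [this]
    refine Finset.sum_le_sum fun p _ => ?_
    nlinarith [sq_nonneg ((charFn τ p).re * (charFn O p).re - (twistedCrossChar τ O p).re)]
  have hS : 0 ≤ S := Finset.sum_nonneg fun _ _ => by positivity
  have hd : (0 : ℝ) < 2 ^ n := by positivity
  set d : ℝ := 2 ^ n
  have h3 : 0 ≤ (τ * O).trace.re ^ 2 / (d + 2) := by positivity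
  have h4 : (d + 1) / (d * (d + 2)) ≤ 1 / d := by
    rw [div_le_div_iff₀ (by positivity) hd]
    nlinarith
  calc _ ≤ (d + 1) / (d * (d + 2)) * (S + S) := by
        have : (d + 1) / (d * (d + 2)) * (S + ∑ p, ((charFn τ p).re * (charFn O p).re) *
          (twistedCrossChar τ O p).re) ≤ (d + 1) / (d * (d + 2)) * (S + S) := by gcongr
        linarith
    _ ≤ 1 / d * (S + S) := by gcongr
    _ = _ := by ring

theorem abs_charFn_re_le {n : ℕ} (A : Op n) (p : Fin n → Fin 4) :
    |(charFn A p).re| ≤ schattenNorm 1 A := by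
  refine (Complex.abs_re_le_norm _).trans ?_
  rw [charFn, Matrix.trace_mul_comm]
  exact norm_trace_unitary_mul_le ⟨pauli p, pauli_mem_unitaryGroup p⟩ A

/-- Bound each coefficient of `τ` by `‖τ‖₁`, a Pauli being unitary, and sum those of `O` by
Parseval. -/
theorem lpNorm_crossChar_le {n : ℕ} {O τ : Op n} (hO : O.IsHermitian) (hτ : τ.IsHermitian) :
    2 / dim n * lpNorm 2 (crossChar τ O) ^ 2 ≤
      2 * schattenNorm 1 τ ^ 2 * schattenNorm 2 O ^ 2 := by
  rw [lpNorm_two_crossChar_sq hτ hO, schattenNorm_two_sq, dim]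
  have h1 : ∑ p, ((charFn τ p).re * (charFn O p).re) ^ 2 ≤
      schattenNorm 1 τ ^ 2 * (2 ^ n * hsSq O) := by
    rw [← sum_charFn_re_sq hO, Finset.mul_sum]
    refine Finset.sum_le_sum fun p _ => ?_
    rw [mul_pow]
    refine mul_le_mul_of_nonneg_right ?_ (sq_nonneg _)
    rw [← sq_abs]
    exact pow_le_pow_left₀ (abs_nonneg _) (abs_charFn_re_le τ p) 2
  calc _ ≤ 2 / 2 ^ n * (schattenNorm 1 τ ^ 2 * (2 ^ n * hsSq O)) := by gcongr
    _ = _ := by field_simp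

theorem two_rpow_stabilizerEntropy {n : ℕ} {σ : Op n} (hσ : IsDensity σ) :
    (2 : ℝ) ^ (2 - stabilizerEntropy σ / 2) =
      4 * Real.sqrt ((∑ p, (charFn σ p).re ^ 4) / 2 ^ n) := by
  have hN : lpNorm 4 (charFn σ) ^ 4 = ∑ p, (charFn σ p).re ^ 4 := by
    rw [lpNorm_four_pow]
    refine Finset.sum_congr rfl fun p _ => ?_
    rw [charFn_eq_re hσ.isHermitian, Complex.norm_real, Real.norm_eq_abs, Complex.ofReal_re,
      pow_abs, abs_of_nonneg (by positivity)]
  -- The identity coefficient of `σ` is its trace, so the sum is positive and the logarithm can be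
  -- undone.
  have hpos : 0 < ∑ p, (charFn σ p).re ^ 4 := by
    refine Finset.sum_pos' (fun _ _ => by positivity) ⟨0, Finset.mem_univ _, ?_⟩
    simp [charFn, pauli_zero, hσ.2]
  rw [stabilizerEntropy, hN, dim]
  set N := ∑ p, (charFn σ p).re ^ 4
  have e : (2 : ℝ) - Real.logb 2 (2 ^ n / N) / 2 = 2 + Real.logb 2 (N / 2 ^ n) * (1 / 2) := by
    have h : Real.logb 2 (2 ^ n / N) = -Real.logb 2 (N / 2 ^ n) := by
      rw [← Real.logb_inv, inv_div]
    rw [h]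
    ring
  rw [e, Real.rpow_add (by norm_num), Real.rpow_mul (by norm_num),
    Real.rpow_logb (by norm_num) (by norm_num) (by positivity), ← Real.sqrt_eq_rpow]
  norm_num

theorem varStar_re_le_of_isPure {n : ℕ} {ρ σ O : Op n} (hρ : IsDensity ρ) (hσ : IsDensity σ)
    (hp : IsPure σ) (hO : O.IsHermitian) (hO0 : O.trace = 0)
    (hOσ : O = σ - ((dim n : ℂ)⁻¹) • (1 : Op n)) :
    (varStar (cliffordEnsemble n) O (ρ - σ)).re ≤ (2 : ℝ) ^ (2 - stabilizerEntropy σ / 2) *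
      min (Real.sqrt 2 * infidelity ρ σ) (schattenNorm 2 (ρ - σ) ^ 2) := by
  have hΔ : (ρ - σ).IsHermitian := hρ.isHermitian.sub hσ.isHermitian
  refine (varStar_re_le hO hΔ hO0).trans ?_
  rw [lpNorm_two_crossChar_sq hΔ hO, two_rpow_stabilizerEntropy hσ, schattenNorm_two_sq, dim]
  have hd : (0 : ℝ) < 2 ^ n := by positivity
  set d : ℝ := 2 ^ n with hddef
  set N := ∑ p, (charFn σ p).re ^ 4 with hN
  set D := ∑ p, (charFn (ρ - σ) p).re ^ 4 with hD
  set h := hsSq (ρ - σ) with hh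
  set ε := infidelity ρ σ with hε
  have hN0 : 0 ≤ N := Finset.sum_nonneg fun _ _ => by positivity
  have hD0 : 0 ≤ D := Finset.sum_nonneg fun _ _ => by positivity
  have hh0 : 0 ≤ h := hsSq_nonneg _
  have hΔε := schattenNorm_one_sub_sq_le hρ hσ
  have hε0 : 0 ≤ ε := by nlinarith [sq_nonneg (schattenNorm 1 (ρ - σ))]
  -- At the identity the coefficient of `ρ - σ` vanishes, and elsewhere `O` and `σ` have the same
  -- coefficients; Cauchy–Schwarz then separates `D` and `N`.
  have hS : ∑ p, ((charFn (ρ - σ) p).re * (charFn O p).re) ^ 2 ≤ Real.sqrt (D * N) := by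
    have e : ∀ p, ((charFn (ρ - σ) p).re * (charFn O p).re) ^ 2 =
        ((charFn (ρ - σ) p).re * (charFn σ p).re) ^ 2 := by
      intro p
      by_cases hp0 : p = 0
      · have h0 : charFn (ρ - σ) p = 0 := by
          rw [charFn, hp0, pauli_zero, Matrix.mul_one, Matrix.trace_sub, hρ.2, hσ.2, sub_self]
        simp [h0]
      · have h1 : charFn O p = charFn σ p := by
          have h2 : (pauli p).trace = 0 := by
            have := trace_pauli_mul_pauli p 0
            rwa [pauli_zero, Matrix.mul_one, if_neg hp0] at this
          rw [charFn, charFn, hOσ, Matrix.sub_mul, Matrix.smul_mul, Matrix.one_mul,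
            Matrix.trace_sub, Matrix.trace_smul, h2, smul_zero, sub_zero]
        rw [h1]
    refine Real.le_sqrt_of_sq_le ?_
    simp only [e, mul_pow]
    have := Finset.sum_mul_sq_le_sq_mul_sq Finset.univ
      (fun p => (charFn (ρ - σ) p).re ^ 2) (fun p => (charFn σ p).re ^ 2)
    simpa only [← pow_mul] using this
  -- Bound one squared factor by its maximum and sum the other by Parseval.
  have hbound : ∀ c, (∀ p, (charFn (ρ - σ) p).re ^ 2 ≤ c) → D ≤ c * (d * h) := by
    intro c hc
    rw [hD, hddef, hh, ← sum_charFn_re_sq hΔ, Finset.mul_sum]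
    refine Finset.sum_le_sum fun p _ => ?_
    nlinarith [hc p, sq_nonneg (charFn (ρ - σ) p).re]
  have hD1 : D ≤ 4 * h * (d * h) := hbound _ (charFn_sub_sq_le_of_isPure hρ hσ hp)
  have hD2 : D ≤ 4 * ε * (d * h) := hbound _ fun p => by
    refine le_trans ?_ hΔε
    rw [← sq_abs]
    exact pow_le_pow_left₀ (abs_nonneg _) (abs_charFn_re_le _ p) 2
  have hhε : h ≤ 2 * ε := hsSq_sub_le_infidelity_of_isPure hρ hσ hp
  -- Both alternatives of the minimum need only `D ≤ 4 d m²`. For `m = √2 ε` this comes from `D ≤ 4ε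
  -- · d h` with `h ≤ 2ε`, and for `m = h` from `D ≤ 4h · d h`.
  have hfin : ∀ m, 0 ≤ m → D ≤ 4 * d * m ^ 2 →
      2 / d * ∑ p, ((charFn (ρ - σ) p).re * (charFn O p).re) ^ 2 ≤
        4 * Real.sqrt (N / d) * m := by
    intro m hm hDm
    have h1 : Real.sqrt (D * N) ≤ 2 * d * m * Real.sqrt (N / d) := by
      rw [Real.sqrt_le_iff]
      refine ⟨by positivity, ?_⟩
      rw [mul_pow, Real.sq_sqrt (by positivity)]
      calc D * N ≤ 4 * d * m ^ 2 * N := by gcongr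
        _ = _ := by field_simp; ring
    calc _ ≤ 2 / d * (2 * d * m * Real.sqrt (N / d)) := by
          gcongr
          exact hS.trans h1
      _ = _ := by field_simp; ring
  rcases min_choice (Real.sqrt 2 * ε) h with hm | hm <;> rw [hm]
  · refine hfin _ (by positivity) ?_
    rw [mul_pow, Real.sq_sqrt (by norm_num)]
    calc D ≤ 4 * ε * (d * h) := hD2
      _ ≤ 4 * ε * (d * (2 * ε)) := by gcongr
      _ = _ := by ring
  · refine hfin _ hh0 (hD1.trans_eq (by ring))

end

end CRM

/-! ### The main theorem -/

theorem theorem3 (n : ℕ) (ρ σ O : CRM.Op n)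
    (hρ : CRM.IsDensity ρ) (hσ : CRM.IsDensity σ)
    (hO : O.IsHermitian) (hO0 : O.trace = 0) :
    IsUnit (CRM.measurementChannel (CRM.cliffordEnsemble n)) ∧
    CRM.varStar (CRM.cliffordEnsemble n) O (ρ - σ) =
      CRM.varCirc O (ρ - σ) - ((ρ - σ) * O).trace ^ 2 / ((CRM.dim n : ℂ) + 2) ∧
    (CRM.varStar (CRM.cliffordEnsemble n) O (ρ - σ)).im = 0 ∧
    (CRM.varStar (CRM.cliffordEnsemble n) O (ρ - σ)).re ≤
      2 / CRM.dim n * CRM.lpNorm 2 (CRM.crossChar (ρ - σ) O) ^ 2 ∧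
    2 / CRM.dim n * CRM.lpNorm 2 (CRM.crossChar (ρ - σ) O) ^ 2 ≤
      2 * CRM.schattenNorm 1 (ρ - σ) ^ 2 * CRM.schattenNorm 2 O ^ 2 ∧
    2 * CRM.schattenNorm 1 (ρ - σ) ^ 2 * CRM.schattenNorm 2 O ^ 2 ≤
      8 * CRM.infidelity ρ σ * CRM.schattenNorm 2 O ^ 2 ∧
    (CRM.IsPure σ → O = σ - ((CRM.dim n : ℂ)⁻¹) • (1 : CRM.Op n) →
      (CRM.varStar (CRM.cliffordEnsemble n) O (ρ - σ)).re ≤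
        (2 : ℝ) ^ (2 - CRM.stabilizerEntropy σ / 2) *
          min (Real.sqrt 2 * CRM.infidelity ρ σ) (CRM.schattenNorm 2 (ρ - σ) ^ 2)) := by
  have hΔ : (ρ - σ).IsHermitian := hρ.isHermitian.sub hσ.isHermitian
  refine ⟨(CRM.isUnit_measurementChannel_clifford n).1, ?_, ?_, CRM.varStar_re_le hO hΔ hO0,
    CRM.lpNorm_crossChar_le hO hΔ, ?_,
    fun hp hOσ => CRM.varStar_re_le_of_isPure hρ hσ hp hO hO0 hOσ⟩
  · rw [CRM.varStar_clifford O _ hO0, CRM.varCirc, CRM.lpNorm_two_crossChar_sq hΔ hO, CRM.dim]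
    have h1 : ((∑ p, ((CRM.charFn (ρ - σ) p).re * (CRM.charFn O p).re) ^ 2 : ℝ) : ℂ) =
        ∑ p, CRM.crossChar (ρ - σ) O p ^ 2 := by
      rw [Complex.ofReal_sum]
      exact Finset.sum_congr rfl fun p _ => by
        rw [CRM.crossChar_eq_re hΔ hO, Complex.ofReal_pow]
    -- The conjugation in the dot product is harmless because the twisted characteristic function is
    -- real.
    have h2 : star (CRM.twistedCrossChar (ρ - σ) O) ⬝ᵥ CRM.crossChar (ρ - σ) O =
        ∑ p, CRM.crossChar (ρ - σ) O p * CRM.twistedCrossChar (ρ - σ) O p := by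
      refine Finset.sum_congr rfl fun p _ => ?_
      rw [Pi.star_apply, CRM.twistedCrossChar_eq_re hΔ hO, mul_comm]
      simp
    rw [h1, h2]
    push_cast
    rfl
  · rw [CRM.varStar_eq_ofReal hO hΔ hO0, Complex.ofReal_im]
  · have h := CRM.schattenNorm_one_sub_sq_le hρ hσ
    have h2 : 0 ≤ CRM.schattenNorm 2 O ^ 2 := sq_nonneg _
    nlinarith
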